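/- Let $\mathbb{T}=(\mathbb{R}\cup\{-\infty\},\max,+)$, let $S\subseteq\mathbb{T}$ be a sub-semifield with value group $\Gamma=\log(S^\times)\subseteq\mathbb{R}$ (we write $t^\gamma\in\mathbb{T}$ for the element corresponding to $\gamma\in\mathbb{R}$, and $\log t^\gamma=\gamma$), let $M\cong\mathbb{Z}^n$ and $N_{\mathbb{R}}=\operatorname{Hom}(M,\mathbb{R})$, and put $\langle (r,x),(\gamma,u)\rangle=r\gamma+x(u)$ for $(r,x)\in\mathbb{R}_{\ge0}\times N_{\mathbb{R}}$, $(\gamma,u)\in\mathbb{R}\times M$. A congruence $P$ on a commutative semiring $A$ is *prime* if it is proper and $A/P$ is totally ordered by $a\le b\Leftrightarrow a+b=b$ and cancellative; $f\le_P g$ means that the class of $f$ is $\le$ the class of $g$ in $A/P$. A *$\Gamma$-admissible cone* is a set $\{w\in\mathbb{R}_{\ge0}\times N_{\mathbb{R}} : \langle w,(\gamma_i,u_i)\rangle\le 0,\ 1\le i\le q\}$ with $\gamma_i\in\Gamma$, $u_i\in M$, $q\geq 0$; a *$\Gamma$-admissible fan support set* is a finite (possibly empty) union of such cones, and these form a lattice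 under inclusion, with meet $\cap$ and join $\cup$. A *flag of cones* $\mathcal{C}_\bullet=(\mathcal{C}_0\le\cdots\le\mathcal{C}_k)$, $k\ge-1$ (the empty flag $k=-1$ is allowed), consists of strongly convex polyhedral cones (not necessarily rational) in $\mathbb{R}_{\ge0}\times N_{\mathbb{R}}$ with $\mathcal{C}_{i-1}$ a face of $\mathcal{C}_i$ and $\dim\mathcal{C}_i=i+1$; it is *simplicial* if every $\mathcal{C}_i$ is simplicial. A *$\Gamma$-admissible neighborhood* of $\mathcal{C}_\bullet$ is a $\Gamma$-admissible cone that meets the relative interior of every $\mathcal{C}_i$; two flags are *($\Gamma$-)locally equivalent* if they have the same $\Gamma$-admissible neighborhoods. For a simplicial flag, $P_{\mathcal{C}_\bullet}$ is the kernel of the semiring homomorphism $S[M]\to\mathbb{R}^{k+1}_{\mathrm{lex}}\cup\{-\infty\}$, $a\chi^u\mapsto(\langle w_i,(\log a,u)\rangle)_{0\le i\le k}$ for $a\neq 0_S$, where $w_i\in\mathcal{C}_i\setminus\mathcal{C}_{i-1}$ are arbitrary points ($\mathcal{C}_{-1}=\{0\}$); it does not depend on their choice. For $f=\sum_u f_u\chi^u\in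 S[M]$ let $\tilde f(r,x)=\max_{u:\,f_u\ne0_S}(r\log f_u+x(u))$ (so $\tilde 0=-\infty$) and $\tilde R(f_0,\dots,f_m)=\{w\in\mathbb{R}_{\ge0}\times N_{\mathbb{R}}:\tilde f_0(w)\ge\tilde f_i(w),\ 1\le i\le m\}$. For a prime congruence $P$ on $S[M]$ let $\tilde{\mathcal{F}}_P$ be the collection of all $\Gamma$-admissible fan support sets $U$ for which there are $f_0,\dots,f_m\in S[M]$ with $\tilde R(f_0,\dots,f_m)\subseteq U$ and $f_i\le_P f_0$ for $1\le i\le m$. **Theorem.** Every flag of cones is locally equivalent to a simplicial one, and there are bijections between 1. the set of all prime congruences on $S[M]$, 2. the set of flags of cones in $\mathbb{R}_{\ge0}\times N_{\mathbb{R}}$ modulo $\Gamma$-local equivalence, 3. the set of prime filters on the lattice of $\Gamma$-admissible fan support sets, where the map from (2) to (1) sends the class of $\mathcal{C}_\bullet$ to $P_{\mathcal{C}'_\bullet}$ for any simplicial flag $\mathcal{C}'_\bullet$ locally equivalent to $\mathcal{C}_\bullet$, and the map from (1) to (3) is $P\mapsto\tilde{\mathcal{F}}_P$. Moreover, sending $P$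 to the restriction of $\le_P$ to the terms $a\chi^u$ ($a\in S^\times$, $u\in M$) is a bijection from (1) to the set of valuated monomial preorders, that is, multiplicative total preorders $\preceq$ on these terms such that $a\le b$ in $S$ implies $a\chi^0\preceq b\chi^0$. Likewise, if $k$ is a field with a valuation $v:k\to\mathbb{T}$ such that $v(k)=S$, then sending $P$ to the relation $a\chi^u\preceq b\chi^\lambda\Leftrightarrow v(a)\chi^u\le_P v(b)\chi^\lambda$ is a bijection from (1) to the set of valuated monomial preorders on $k[M]$, that is, multiplicative total preorders on the monomials $a\chi^u$ ($a\in k^\times$, $u\in M$) such that $v(a)\le v(b)$ implies $a\chi^0\preceq b\chi^0$. -/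

import Mathlib

/-! ### Max-plus semirings -/

/-- The max-plus semiring `G ∪ {-∞}` of a totally ordered abelian group `G`: addition is the
maximum and multiplication is the addition of `G`. It is Mathlib's min-plus semiring of `G` with
the order reversed, so that `min` is the maximum of `G` and the top element is `-∞`. -/
abbrev MaxPlus (G : Type*) := Tropical (WithTop (OrderDual G))

/-- The tropical semifield `𝕋 = ℝ ∪ {-∞}` with `max` and `+`. -/
abbrev TropReal := MaxPlus ℝ

/-- `ℝ^k ∪ {-∞}` with the lexicographic maximum and pointwise addition. -/
abbrev LexTrop (k : ℕ) := MaxPlus (Lex (Fin k → ℝ))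

/-- The finite element `t^g` of `G ∪ {-∞}` corresponding to `g ∈ G`. -/
def MaxPlus.tPow {G : Type*} (g : G) : MaxPlus G :=
  Tropical.trop ((OrderDual.toDual g : OrderDual G) : WithTop (OrderDual G))

/-- The real number corresponding to a nonzero element of `𝕋`
(only used for nonzero elements; the value at `0_𝕋 = -∞` is a dummy). -/
def TropReal.log (a : TropReal) : ℝ :=
  OrderDual.ofDual (WithTop.untopD (OrderDual.toDual (0 : ℝ)) (Tropical.untrop a))

/-- A subsemiring of `𝕋` is a sub-semifield if its nonzero elements are invertible in it. -/
def IsSubsemifield (S : Subsemiring TropReal) : Prop :=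
  ∀ a ∈ S, a ≠ 0 → ∃ b ∈ S, a * b = 1

/-- The value group `Γ = log (S^×) ⊆ ℝ`. -/
def valueGroup (S : Subsemiring TropReal) : Set ℝ :=
  {γ | MaxPlus.tPow γ ∈ S}

/-! ### The ambient space `ℝ_{≥0} × N_ℝ` -/

/-- `N_ℝ = Hom(M, ℝ)`. -/
abbrev NReal (M : Type*) [AddCommGroup M] := M →+ ℝ

/-- The topology of pointwise convergence on `Hom(M, ℝ)`; for `M ≅ ℤ^n` it is the usual topology
of `ℝ^n`. -/
instance NReal.instTopologicalSpace (M : Type*) [AddCommGroup M] : TopologicalSpace (NReal M) :=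
  TopologicalSpace.induced (fun (x : M →+ ℝ) (u : M) => x u) inferInstance

/-- The real vector space `ℝ × N_ℝ`, which contains `ℝ_{≥0} × N_ℝ`. -/
abbrev RN (M : Type*) [AddCommGroup M] := ℝ × NReal M

/-- The pairing `⟨(r, x), (γ, u)⟩ = r γ + ⟨x, u⟩`. -/
def pairing {M : Type*} [AddCommGroup M] (w : RN M) (γ : ℝ) (u : M) : ℝ :=
  w.1 * γ + w.2 u

/-! ### Admissible cones, fan support sets, prime filters -/

section Admissible

variable {M : Type*} [AddCommGroup M]

/-- `Γ`-admissible cones in `ℝ_{≥0} × N_ℝ`. -/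
def IsAdmissibleCone (Γ : Set ℝ) (D : Set (RN M)) : Prop :=
  ∃ (q : ℕ) (γ : Fin q → ℝ) (u : Fin q → M), (∀ i, γ i ∈ Γ) ∧
    D = {w | 0 ≤ w.1 ∧ ∀ i, pairing w (γ i) (u i) ≤ 0}

/-- `Γ`-admissible fan support sets: finite unions of `Γ`-admissible cones. -/
def IsFanSupport (Γ : Set ℝ) (U : Set (RN M)) : Prop :=
  ∃ (m : ℕ) (D : Fin m → Set (RN M)), (∀ i, IsAdmissibleCone Γ (D i)) ∧ U = ⋃ i, D i

theorem IsAdmissibleCone.inter {Γ : Set ℝ} {D E : Set (RN M)}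
    (hD : IsAdmissibleCone Γ D) (hE : IsAdmissibleCone Γ E) : IsAdmissibleCone Γ (D ∩ E) := by
  obtain ⟨q, γ, u, hγ, rfl⟩ := hD
  obtain ⟨q', γ', u', hγ', rfl⟩ := hE
  refine ⟨q + q', Fin.append γ γ', Fin.append u u', fun i => ?_, ?_⟩
  · refine Fin.addCases (fun j => ?_) (fun j => ?_) i
    · simpa using hγ j
    · simpa using hγ' j
  · ext w
    constructor
    · rintro ⟨⟨h0, h⟩, -, h'⟩
      refine ⟨h0, fun i => ?_⟩
      refine Fin.addCases (fun j => ?_) (fun j => ?_) i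
      · simpa using h j
      · simpa using h' j
    · rintro ⟨h0, h⟩
      refine ⟨⟨h0, fun j => ?_⟩, h0, fun j => ?_⟩
      · simpa using h (Fin.castAdd q' j)
      · simpa using h (Fin.natAdd q j)

theorem isFanSupport_iff {Γ : Set ℝ} {U : Set (RN M)} :
    IsFanSupport Γ U ↔ ∃ T : Set (Set (RN M)), T.Finite ∧ (∀ D ∈ T, IsAdmissibleCone Γ D) ∧
      U = ⋃₀ T := by
  constructor
  · rintro ⟨m, D, hD, rfl⟩
    refine ⟨Set.range D, Set.finite_range D, ?_, ?_⟩
    · rintro _ ⟨i, rfl⟩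
      exact hD i
    · rw [Set.sUnion_range]
  · rintro ⟨T, hT, hD, rfl⟩
    have := hT.fintype
    let e := Fintype.equivFin T
    refine ⟨Fintype.card T, fun i => (e.symm i : Set (RN M)), fun i => hD _ (e.symm i).2, ?_⟩
    rw [Set.sUnion_eq_iUnion]
    exact (e.symm.surjective.iUnion_comp (fun D : T => (D : Set (RN M)))).symm

theorem IsFanSupport.union {Γ : Set ℝ} {U V : Set (RN M)}
    (hU : IsFanSupport Γ U) (hV : IsFanSupport Γ V) : IsFanSupport Γ (U ∪ V) := by
  rw [isFanSupport_iff] at *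
  obtain ⟨T, hT, hD, rfl⟩ := hU
  obtain ⟨T', hT', hD', rfl⟩ := hV
  refine ⟨T ∪ T', hT.union hT', ?_, (Set.sUnion_union T T').symm⟩
  rintro D (h | h)
  · exact hD D h
  · exact hD' D h

theorem IsFanSupport.inter {Γ : Set ℝ} {U V : Set (RN M)}
    (hU : IsFanSupport Γ U) (hV : IsFanSupport Γ V) : IsFanSupport Γ (U ∩ V) := by
  rw [isFanSupport_iff] at *
  obtain ⟨T, hT, hD, rfl⟩ := hU
  obtain ⟨T', hT', hD', rfl⟩ := hV
  refine ⟨Set.image2 (· ∩ ·) T T', hT.image2 _ hT', ?_, ?_⟩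
  · rintro _ ⟨D, h, E, h', rfl⟩
    exact (hD D h).inter (hD' E h')
  · ext w
    simp only [Set.mem_inter_iff, Set.mem_sUnion, Set.mem_image2]
    constructor
    · rintro ⟨⟨D, h, hw⟩, E, h', hw'⟩
      exact ⟨D ∩ E, ⟨D, h, E, h', rfl⟩, hw, hw'⟩
    · rintro ⟨_, ⟨D, h, E, h', rfl⟩, hw, hw'⟩
      exact ⟨⟨D, h, hw⟩, E, h', hw'⟩

/-- The set of `Γ`-admissible fan support sets in `ℝ_{≥0} × N_ℝ`. -/
def FanSet (Γ : Set ℝ) (M : Type*) [AddCommGroup M] := {U : Set (RN M) // IsFanSupport Γ U}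

/-- The lattice of `Γ`-admissible fan support sets: ordered by inclusion, with union and
intersection as join and meet. -/
instance FanSet.instLattice (Γ : Set ℝ) : Lattice (FanSet Γ M) :=
  Subtype.lattice (P := IsFanSupport Γ) (fun _ _ hU hV => hU.union hV)
    (fun _ _ hU hV => hU.inter hV)

/-- The set of prime filters on the lattice of `Γ`-admissible fan support sets. -/
def FanPrimeFilter (Γ : Set ℝ) (M : Type*) [AddCommGroup M] :=
  {F : Order.PFilter (FanSet Γ M) // F.IsPrime}

end Admissible

/-! ### Flags of cones and local equivalence -/

/-- A flag `C_0 ≤ C_1 ≤ ⋯ ≤ C_{len - 1}` of strongly convex polyhedral cones in `ℝ_{≥0} × N_ℝ`,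
each a face of the next one, with `dim C_i = i + 1`. The empty flag is allowed. -/
structure ConeFlag (M : Type*) [AddCommGroup M] where
  /-- The number of cones in the flag. -/
  len : ℕ
  /-- The cones of the flag. -/
  cone : Fin len → PointedCone ℝ (RN M)
  polyhedral : ∀ i, (cone i).FG
  salient : ∀ i, ((cone i : PointedCone ℝ (RN M)) : ConvexCone ℝ (RN M)).Salient
  fst_nonneg : ∀ i, ∀ w ∈ cone i, 0 ≤ w.1
  finrank_span : ∀ i,
    Module.finrank ℝ (Submodule.span ℝ (cone i : Set (RN M))) = (i : ℕ) + 1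
  face : ∀ i j : Fin len, (i : ℕ) + 1 = j → (cone i).IsFaceOf (cone j)

namespace ConeFlag

variable {M : Type*} [AddCommGroup M]

/-- A flag is simplicial if all its cones are. -/
def IsSimplicial (C : ConeFlag M) : Prop := ∀ i, (C.cone i).IsSimplicial

/-- `D` is a `Γ`-admissible neighborhood of the flag: a `Γ`-admissible cone that meets the relative
interior of every cone of the flag. -/
def IsNeighborhood (Γ : Set ℝ) (C : ConeFlag M) (D : Set (RN M)) : Prop :=
  IsAdmissibleCone Γ D ∧
    ∀ i, (D ∩ intrinsicInterior ℝ (C.cone i : Set (RN M))).Nonempty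

/-- `Γ`-local equivalence: the two flags have the same `Γ`-admissible neighborhoods. -/
def LocEquiv (Γ : Set ℝ) (C C' : ConeFlag M) : Prop :=
  ∀ D : Set (RN M), C.IsNeighborhood Γ D ↔ C'.IsNeighborhood Γ D

/-- `Γ`-local equivalence as an equivalence relation on flags. -/
def locSetoid (Γ : Set ℝ) (M : Type*) [AddCommGroup M] : Setoid (ConeFlag M) where
  r := LocEquiv Γ
  iseqv := ⟨fun _ _ => Iff.rfl, fun h D => (h D).symm, fun h h' D => (h D).trans (h' D)⟩

/-- The cone `C_{i-1}`, with `C_{-1} = {0}`. -/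
def prev (C : ConeFlag M) (i : Fin C.len) : PointedCone ℝ (RN M) :=
  if (i : ℕ) = 0 then ⊥ else C.cone ⟨(i : ℕ) - 1, by omega⟩

/-- A choice of points `w_i ∈ C_i \ C_{i-1}`. -/
structure Selection (C : ConeFlag M) where
  /-- The chosen points. -/
  pt : Fin C.len → RN M
  mem : ∀ i, pt i ∈ C.cone i
  notMem : ∀ i, pt i ∉ C.prev i

end ConeFlag

/-! ### The prime congruence of a matrix with rows in `ℝ_{≥0} × N_ℝ` -/

section Matrix

variable {M : Type*} [AddCommGroup M] {k : ℕ}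

/-- For `r ∈ ℝ_{≥0}^k`, the semiring homomorphism `𝕋 → ℝ^k_lex ∪ {-∞}`,
`t^γ ↦ t^(r_1 γ, …, r_k γ)`, `0 ↦ 0`. -/
noncomputable def coeffHom (r : Fin k → ℝ) (hr : ∀ i, 0 ≤ r i) : TropReal →+* LexTrop k where
  toFun a := Tropical.trop ((Tropical.untrop a).map
    fun γ => OrderDual.toDual (toLex fun i => r i * OrderDual.ofDual γ))
  map_zero' := rfl
  map_one' := by
    change Tropical.trop _ = Tropical.trop _
    congr 1
    change WithTop.map _ ((0 : OrderDual ℝ) : WithTop (OrderDual ℝ)) = ((0 : _) : WithTop _)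
    rw [WithTop.map_coe]
    congr 1
    change toLex (fun i => r i * (0 : ℝ)) = toLex 0
    congr 1
    funext i
    simp
  map_mul' a b := by
    induction a using Tropical.tropRec with | _ a => ?_
    induction b using Tropical.tropRec with | _ b => ?_
    change Tropical.trop (WithTop.map _ (a + b)) = Tropical.trop (WithTop.map _ a + WithTop.map _ b)
    congr 1
    induction a with
    | top => rfl
    | coe a =>
      induction b with
      | top => rfl
      | coe b =>
        rw [← WithTop.coe_add, WithTop.map_coe, WithTop.map_coe, WithTop.map_coe, ← WithTop.coe_add]
        congr 1
        change toLex (fun i => r i * (OrderDual.ofDual a + OrderDual.ofDual b)) =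
          toLex ((fun i => r i * OrderDual.ofDual a) + fun i => r i * OrderDual.ofDual b)
        congr 1
        funext i
        simp [mul_add]
  map_add' a b := by
    have hm : Monotone (fun γ : OrderDual ℝ =>
        (OrderDual.toDual (toLex fun i => r i * OrderDual.ofDual γ) :
          OrderDual (Lex (Fin k → ℝ)))) := by
      intro x y hxy
      exact Pi.toLex_monotone fun i =>
        mul_le_mul_of_nonneg_left (show OrderDual.ofDual y ≤ OrderDual.ofDual x from hxy) (hr i)
    exact congrArg Tropical.trop
      ((WithTop.monotone_map_iff.2 hm).map_min (a := Tropical.untrop a) (b := Tropical.untrop b))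

/-- For `ξ ∈ N_ℝ^k`, the monoid homomorphism `M → ℝ^k_lex ∪ {-∞}`,
`u ↦ t^(⟨ξ_1, u⟩, …, ⟨ξ_k, u⟩)`. -/
noncomputable def expHom (ξ : Fin k → NReal M) : Multiplicative M →* LexTrop k where
  toFun u := MaxPlus.tPow (toLex fun i => ξ i u.toAdd)
  map_one' := by
    change MaxPlus.tPow _ = MaxPlus.tPow (0 : Lex (Fin k → ℝ))
    congr 1
    change toLex (fun i => ξ i 0) = toLex 0
    congr 1
    funext i
    simp
  map_mul' u v := by
    change MaxPlus.tPow _ = MaxPlus.tPow (toLex (fun i => ξ i u.toAdd) + toLex fun i => ξ i v.toAdd)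
    congr 1
    change toLex (fun i => ξ i (u.toAdd + v.toAdd)) =
      toLex ((fun i => ξ i u.toAdd) + fun i => ξ i v.toAdd)
    congr 1
    funext i
    simp

/-- The semiring homomorphism `φ_w : S[M] → ℝ^k_lex ∪ {-∞}` of points `w_1, …, w_k` of
`ℝ_{≥0} × N_ℝ`, given on terms by `a χ^u ↦ (⟨w_1, (log a, u)⟩, …, ⟨w_k, (log a, u)⟩)`. -/
noncomputable def phi (S : Subsemiring TropReal) (w : Fin k → RN M) (hw : ∀ i, 0 ≤ (w i).1) :
    AddMonoidAlgebra S M →+* LexTrop k :=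
  AddMonoidAlgebra.liftNCRingHom ((coeffHom (fun i => (w i).1) hw).comp S.subtype)
    (expHom fun i => (w i).2) (fun _ _ => Commute.all _ _)

/-- On a term with nonzero coefficient `t^γ`, `φ_w` is given by the pairings with the `w_i`. -/
theorem phi_single (S : Subsemiring TropReal) (w : Fin k → RN M) (hw : ∀ i, 0 ≤ (w i).1)
    (γ : ℝ) (hγ : γ ∈ valueGroup S) (u : M) :
    phi S w hw (AddMonoidAlgebra.single u ⟨MaxPlus.tPow γ, hγ⟩) =
      MaxPlus.tPow (toLex fun i => pairing (w i) γ u) := by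
  rw [phi, AddMonoidAlgebra.liftNCRingHom_single]
  rfl

/-- The congruence `P_w = ker φ_w` on `S[M]`. -/
noncomputable def congOfPoints (S : Subsemiring TropReal) (w : Fin k → RN M)
    (hw : ∀ i, 0 ≤ (w i).1) : RingCon (AddMonoidAlgebra S M) :=
  RingCon.ker (phi S w hw)

/-- The congruence defined by a flag through points `w_i ∈ C_i \ C_{i-1}`. -/
noncomputable def ConeFlag.Selection.cong (S : Subsemiring TropReal) {C : ConeFlag M}
    (w : C.Selection) : RingCon (AddMonoidAlgebra S M) :=
  congOfPoints S w.pt fun i => C.fst_nonneg i _ (w.mem i)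

end Matrix

/-! ### Prime congruences and their filters -/

/-- A congruence is prime if it is proper and the quotient is totally ordered (for the canonical
order `a ≤ b ↔ a + b = b`) and cancellative. -/
structure IsPrimeCongruence {A : Type*} [CommSemiring A] (P : RingCon A) : Prop where
  proper : ¬ P 0 1
  total : ∀ a b : P.Quotient, a + b = b ∨ b + a = a
  cancel : ∀ a b c : P.Quotient, a ≠ 0 → a * b = a * c → b = c

/-- The set of prime congruences on `A`. -/
def PrimeCongruence (A : Type*) [CommSemiring A] := {P : RingCon A // IsPrimeCongruence P}

/-- `f ≤_P g`, i.e. `|f|_P ≤ |g|_P` in the canonical order of `A / P`. -/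
def RingCon.leAt {A : Type*} [CommSemiring A] (P : RingCon A) (f g : A) : Prop :=
  (f : P.Quotient) + (g : P.Quotient) = (g : P.Quotient)

section Filter

variable {M : Type*} [AddCommGroup M]

/-- The homogenized function `f̃(r, x) = max_u (r log f_u + ⟨x, u⟩)`, the maximum over the `u` with
`f_u ≠ 0`; it is `-∞` for `f = 0`. -/
noncomputable def homEval {S : Subsemiring TropReal} (f : AddMonoidAlgebra S M) (w : RN M) :
    WithBot ℝ :=
  f.coeff.support.sup fun u => ((pairing w (TropReal.log (f.coeff u)) u : ℝ) : WithBot ℝ)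

/-- The set `R̃(f_0, f_1, …, f_m) = {w ∈ ℝ_{≥0} × N_ℝ : f̃_0(w) ≥ f̃_i(w) for 1 ≤ i ≤ m}`. -/
def ratSet {S : Subsemiring TropReal} {m : ℕ} (f₀ : AddMonoidAlgebra S M)
    (f : Fin m → AddMonoidAlgebra S M) : Set (RN M) :=
  {w | 0 ≤ w.1 ∧ ∀ i, homEval (f i) w ≤ homEval f₀ w}

/-- The collection `F̃_P` of the `Γ`-admissible fan support sets `U` that contain some
`R̃(f_0, f_1, …, f_m)` with `|f_0|_P ≥ |f_i|_P` for `1 ≤ i ≤ m`. -/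
def filterOf {S : Subsemiring TropReal} (P : RingCon (AddMonoidAlgebra S M)) :
    Set (FanSet (valueGroup S) M) :=
  {U | ∃ (m : ℕ) (f₀ : AddMonoidAlgebra S M) (f : Fin m → AddMonoidAlgebra S M),
    ratSet f₀ f ⊆ U.1 ∧ ∀ i, P.leAt (f i) f₀}

end Filter

/-! ### Valuated monomial preorders -/

/-- A valuated monomial preorder on the monomials `a χ^u` with `a ∈ K^×`, `u ∈ M`, where
`val : K^× → 𝕋` gives the values of the coefficients: a multiplicative total preorder such that
`val a ≤ val b` implies `a χ^0 ≤ b χ^0`. The canonical order of `𝕋` is `x ≤ y ↔ x + y = y`. -/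
structure IsValuatedMonomialPreorder {K M : Type*} [Monoid K] [AddCommGroup M]
    (val : Kˣ → TropReal) (le : Kˣ × M → Kˣ × M → Prop) : Prop where
  refl : ∀ x, le x x
  trans : ∀ x y z, le x y → le y z → le x z
  total : ∀ x y, le x y ∨ le y x
  mul : ∀ (x y z : Kˣ × M), le x y → le (x.1 * z.1, x.2 + z.2) (y.1 * z.1, y.2 + z.2)
  val_le : ∀ a b : Kˣ, val a + val b = val b → le (a, 0) (b, 0)

/-- The set of valuated monomial preorders. -/
def ValuatedMonomialPreorder {K : Type*} [Monoid K] (M : Type*) [AddCommGroup M]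
    (val : Kˣ → TropReal) :=
  {le : Kˣ × M → Kˣ × M → Prop // IsValuatedMonomialPreorder val le}

/-!
Every bijection of the theorem is obtained by comparing both sides with one kind of object, the
*order cones*: the sets `Q ⊆ Γ × M` of elements `≤ 0` for a translation-invariant total preorder on
the abelian group `Γ × M` that extends the order of `Γ` (`IsOrderCone`).

* A prime congruence `P` gives the pairs `(γ, u)` with `t^γ χ^u ≤_P 1` (`termCone`). Since `S[M] /
  P` is totally ordered and idempotent, a sum is the largest of its terms, so `P` is determined by
  its order cone (`IsPrimeCongruence.leAt_iff`).
* Every order cone is lexicographic: it consists of the `a` for which the vector `(⟨w_1, a⟩, …,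
  ⟨w_k, a⟩)` is lexicographically at most `0`, for some linearly independent `w_i` in `ℝ_{≥0} ×
  N_ℝ` (`IsOrderCone.exists_eq_lexCone`). This is the main step. Any subgroup `L` of `Γ × M` has a
  strong unit, as `M` is finitely generated and `Γ` is archimedean; so, if the preorder is
  nontrivial on `L`, a form of Hölder's theorem gives a nonzero monotone homomorphism `L → ℝ`, and
  this is the pairing with a point of `ℝ_{≥0} × N_ℝ` because `ℝ` is an injective abelian group.
  Passing to kernels yields the `w_i` one after the other, at most `dim (ℝ × N_ℝ)` of them. As
  `P_w` has the order cone of `w`, all order cones come from prime congruences.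
* Linearly independent points `w_i` span a simplicial flag (`ConeFlag.ofLinearIndependent`). For
  any flag and any points `w_i ∈ C_i \ C_{i-1}`, an admissible cone is a neighborhood of the flag
  if and only if its defining functionals lie in the order cone of `w`
  (`ConeFlag.isNeighborhood_iff`): modulo the span of `C_{i-1}`, the cone `C_i` is a ray, so all
  choices of the `w_i` give the same lexicographic signs, and `w_1 + ε w_2 + ε² w_3 + ⋯` has the
  lexicographic sign on finitely many functionals once `ε > 0` is small. Hence flags up to local
  equivalence are order cones.
* A prime filter is determined by the half-spaces `{⟨·, a⟩ ≤ 0}` that it contains, and these `a`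
  form an order cone (`mem_iff_containsCone_filterCone`). Conversely, the sets that contain a cone
  with defining functionals in an order cone form a prime filter; primality is the same
  perturbation argument (`IsOrderCone.exists_separating`).
* A valuated monomial preorder depends only on the exponents `(log (val a), u)` of the monomials
  (`IsValuationOnto.le_iff_exists`), so it is an order cone in disguise.
-/

/-! ### Finite elements of the max-plus semiring -/

namespace MaxPlus

variable {G : Type*}

theorem tPow_ne_zero (g : G) : tPow g ≠ 0 := fun h =>
  WithTop.coe_ne_top (Tropical.trop_injective h)

theorem tPow_zero [AddCommGroup G] : tPow (0 : G) = 1 := rfl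

theorem tPow_add [AddCommGroup G] (g h : G) : tPow (g + h) = tPow g * tPow h := rfl

theorem exists_eq_tPow {a : MaxPlus G} (ha : a ≠ 0) : ∃ g : G, a = tPow g := by
  induction a using Tropical.tropRec with | _ a => ?_
  induction a with
  | top => exact absurd rfl ha
  | coe a => exact ⟨OrderDual.ofDual a, rfl⟩

theorem tPow_add_tPow_eq_right_iff [LinearOrder G] (g h : G) :
    tPow g + tPow h = tPow h ↔ g ≤ h := by
  rw [Tropical.add_eq_right_iff, tPow, tPow, ← Tropical.untrop_le_iff, Tropical.untrop_trop,
    Tropical.untrop_trop, WithTop.coe_le_coe, OrderDual.toDual_le_toDual]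

theorem add_total [LinearOrder G] (a b : MaxPlus G) : a + b = b ∨ b + a = a := by
  rw [Tropical.add_eq_right_iff, Tropical.add_eq_right_iff]
  exact le_total b a

theorem mul_left_cancel₀ [AddCommGroup G] {a b c : MaxPlus G} (ha : a ≠ 0)
    (h : a * b = a * c) : b = c := by
  obtain ⟨g, rfl⟩ := exists_eq_tPow ha
  have h1 : tPow (-g) * tPow g = (1 : MaxPlus G) := by
    rw [← tPow_add, neg_add_cancel, tPow_zero]
  have := congrArg (tPow (-g) * ·) h
  simpa [← mul_assoc, h1] using this

end MaxPlus

theorem TropReal.log_tPow (γ : ℝ) : TropReal.log (MaxPlus.tPow γ) = γ := rfl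

theorem TropReal.tPow_log {a : TropReal} (ha : a ≠ 0) : MaxPlus.tPow (TropReal.log a) = a := by
  obtain ⟨γ, rfl⟩ := MaxPlus.exists_eq_tPow ha
  rfl

/-! ### Lexicographic signs -/

/-- The vector `v` is lexicographically at most `0`: its first nonzero entry, if there is one, is
negative. -/
def LexNonpos {k : ℕ} (v : Fin k → ℝ) : Prop :=
  ∀ i, (∀ j < i, v j = 0) → v i ≤ 0

theorem lexNonpos_iff {k : ℕ} (v : Fin k → ℝ) : LexNonpos v ↔ toLex v ≤ 0 := by
  constructor
  · intro h
    by_contra! hlt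
    obtain ⟨i, hi, hi'⟩ := hlt
    exact absurd (h i fun j hj => (hi j hj).symm) (not_le.2 hi')
  · exact fun h i hi => Pi.apply_le_of_toLex (y := 0) h hi

theorem LexNonpos.add {k : ℕ} {v w : Fin k → ℝ} (hv : LexNonpos v) (hw : LexNonpos w) :
    LexNonpos (v + w) := by
  rw [lexNonpos_iff] at *
  exact add_nonpos hv hw

theorem LexNonpos.total {k : ℕ} (v : Fin k → ℝ) : LexNonpos v ∨ LexNonpos (-v) := by
  rw [lexNonpos_iff, lexNonpos_iff]
  exact (le_total (toLex v) 0).imp_right fun h => neg_nonpos.2 h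

theorem LexNonpos.eq_zero {k : ℕ} {v : Fin k → ℝ} (hv : LexNonpos v) (hv' : LexNonpos (-v)) :
    v = 0 := by
  rw [lexNonpos_iff] at *
  exact toLex.injective (le_antisymm hv (neg_nonpos.1 hv'))

open Filter Topology in
/-- A vector that is lexicographically at most `0` stays nonpositive when its entries are weighted
by the powers of a small `ε > 0`: the first nonzero entry dominates the rest. -/
theorem LexNonpos.eventually_sum_nonpos : ∀ {k : ℕ} {v : Fin k → ℝ}, LexNonpos v →
    ∀ᶠ ε : ℝ in 𝓝[>] 0, ∑ j : Fin k, ε ^ (j : ℕ) * v j ≤ 0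
  | 0, _, _ => by simp
  | k + 1, v, hv => by
    have hsum : ∀ ε : ℝ, ∑ j : Fin (k + 1), ε ^ (j : ℕ) * v j
        = v 0 + ε * ∑ j : Fin k, ε ^ (j : ℕ) * v j.succ := fun ε => by
      rw [Fin.sum_univ_succ, Finset.mul_sum]
      simp [pow_succ', mul_assoc]
    rcases (hv 0 (by simp)).lt_or_eq with h0 | h0
    · have hc : Continuous fun ε : ℝ => ∑ j : Fin (k + 1), ε ^ (j : ℕ) * v j := by fun_prop
      have h1 : (fun ε : ℝ => ∑ j : Fin (k + 1), ε ^ (j : ℕ) * v j) 0 < 0 := by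
        simpa only [hsum, zero_mul, add_zero] using h0
      filter_upwards [nhdsWithin_le_nhds (hc.continuousAt.eventually_lt_const h1)] with ε hε
      exact hε.le
    · have htail : LexNonpos fun j : Fin k => v j.succ := fun i hi => hv i.succ fun j hj => by
        induction j using Fin.cases with
        | zero => exact h0
        | succ j => exact hi j (Fin.succ_lt_succ_iff.1 hj)
      filter_upwards [htail.eventually_sum_nonpos, self_mem_nhdsWithin] with ε hε hpos
      rw [hsum, h0, zero_add]
      exact mul_nonpos_of_nonneg_of_nonpos (le_of_lt hpos) hε

open Filter Topology in
theorem eventually_sum_pos_of_not_lexNonpos {k : ℕ} {v : Fin k → ℝ} (hv : ¬ LexNonpos v) :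
    ∀ᶠ ε : ℝ in 𝓝[>] 0, 0 < ∑ j : Fin k, ε ^ (j : ℕ) * v j := by
  induction k with
  | zero => exact absurd (fun i => i.elim0) hv
  | succ k ih =>
    have hsum : ∀ ε : ℝ, ∑ j : Fin (k + 1), ε ^ (j : ℕ) * v j
        = v 0 + ε * ∑ j : Fin k, ε ^ (j : ℕ) * v j.succ := fun ε => by
      rw [Fin.sum_univ_succ, Finset.mul_sum]
      simp [pow_succ', mul_assoc]
    rcases lt_trichotomy (v 0) 0 with h0 | h0 | h0
    · refine absurd (fun i hi => ?_) hv
      induction i using Fin.cases with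
      | zero => exact h0.le
      | succ i => exact absurd (hi 0 (Fin.succ_pos i)) h0.ne
    · have htail : ¬ LexNonpos fun j : Fin k => v j.succ := fun h => hv fun i hi => by
        induction i using Fin.cases with
        | zero => exact h0.le
        | succ i => exact h i fun j hj => hi j.succ (Fin.succ_lt_succ_iff.2 hj)
      filter_upwards [ih htail, self_mem_nhdsWithin] with ε hε hpos
      rw [hsum, h0, zero_add]
      exact mul_pos hpos hε
    · have hc : Continuous fun ε : ℝ => ∑ j : Fin (k + 1), ε ^ (j : ℕ) * v j := by fun_prop
      have h1 : 0 < (fun ε : ℝ => ∑ j : Fin (k + 1), ε ^ (j : ℕ) * v j) 0 := by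
        simpa only [hsum, zero_mul, add_zero] using h0
      exact nhdsWithin_le_nhds (hc.continuousAt.eventually_const_lt h1)

/-! ### The pairing -/

section Pairing

variable {M : Type*} [AddCommGroup M]

/-- The linear functional `⟨·, a⟩` on `ℝ × N_ℝ` for `a ∈ ℝ × M`. -/
def pairingLin (a : ℝ × M) : RN M →ₗ[ℝ] ℝ where
  toFun w := pairing w a.1 a.2
  map_add' v w := by simp only [pairing, Prod.fst_add, Prod.snd_add, AddMonoidHom.add_apply]; ring
  map_smul' c w := by
    simp only [pairing, Prod.smul_fst, Prod.smul_snd, AddMonoidHom.smul_apply, smul_eq_mul,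
      RingHom.id_apply]
    ring

theorem pairingLin_apply (a : ℝ × M) (w : RN M) : pairingLin a w = pairing w a.1 a.2 := rfl

theorem pairingLin_add (a b : ℝ × M) (w : RN M) :
    pairingLin (a + b) w = pairingLin a w + pairingLin b w := by
  simp only [pairingLin_apply, pairing, Prod.fst_add, Prod.snd_add, map_add]; ring

theorem pairingLin_neg (a : ℝ × M) (w : RN M) : pairingLin (-a) w = -pairingLin a w := by
  simp only [pairingLin_apply, pairing, Prod.fst_neg, Prod.snd_neg, map_neg]; ring

theorem pairingLin_zero (w : RN M) : pairingLin (0 : ℝ × M) w = 0 := by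
  simp [pairingLin_apply, pairing]

end Pairing

/-! ### Real-valued homomorphisms on preordered groups with a strong unit -/

/-- A weak form of Hölder's theorem. Let `N` be the set of elements `≤ 0` of a translation-invariant
total preorder on an abelian group, and let `e > 0` be a strong unit, i.e. every element is at most
some multiple of `e`. Then there is a monotone homomorphism to `ℝ` with value `1` at `e`; it sends
`x` to the supremum of the fractions `p / q` with `p e ≤ q x`. -/
theorem exists_monotone_addMonoidHom {G : Type*} [AddCommGroup G] (N : AddSubmonoid G)
    (total : ∀ x, x ∈ N ∨ -x ∈ N) {e : G} (he : e ∉ N)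
    (unit : ∀ x : G, ∃ n : ℕ, x - n • e ∈ N) :
    ∃ h : G →+ ℝ, (∀ x ∈ N, h x ≤ 0) ∧ h e = 1 := by
  have hne : -e ∈ N := (total e).resolve_left he
  -- a multiple `m e` is `≤ 0` only if `m ≤ 0`
  have hmul : ∀ m : ℤ, m • e ∈ N → m ≤ 0 := by
    intro m hm
    by_contra! hpos
    apply he
    obtain ⟨k, rfl⟩ : ∃ k : ℕ, m = k + 1 := ⟨(m - 1).toNat, by omega⟩
    have h1 : k • (-e) ∈ N := N.nsmul_mem hne k
    have h2 : (k + 1 : ℤ) • e + k • (-e) = e := by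
      rw [add_smul, one_smul, natCast_zsmul, smul_neg]; abel
    rw [← h2]
    exact N.add_mem hm h1
  have hneg : ∀ m : ℤ, m ≤ 0 → m • e ∈ N := by
    intro m hm
    obtain ⟨k, rfl⟩ : ∃ k : ℕ, m = -k := ⟨(-m).toNat, by omega⟩
    rw [neg_smul, natCast_zsmul, ← smul_neg]
    exact N.nsmul_mem hne k
  let lo : G → Set ℝ := fun x => {r | ∃ (p : ℤ) (q : ℕ), 0 < q ∧ p • e - q • x ∈ N ∧ r = p / q}
  -- comparison of lower and upper fractions
  have hcmp : ∀ (x : G) (p p' : ℤ) (q q' : ℕ), 0 < q → 0 < q' → p • e - q • x ∈ N →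
      q' • x - p' • e ∈ N → (p / q : ℝ) ≤ p' / q' := by
    intro x p p' q q' hq hq' h h'
    have h1 : (q' * p - q * p' : ℤ) • e ∈ N := by
      have := N.add_mem (N.nsmul_mem h q') (N.nsmul_mem h' q)
      convert this using 1
      simp only [sub_smul, mul_smul, smul_sub, natCast_zsmul]
      rw [smul_comm q' q x]
      abel
    have h2 := hmul _ h1
    rw [div_le_div_iff₀ (by exact_mod_cast hq) (by exact_mod_cast hq')]
    have h3 : (p * q' : ℤ) ≤ p' * q := by linarith
    exact_mod_cast h3
  have hbdd : ∀ x, BddAbove (lo x) := by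
    intro x
    obtain ⟨n, hn⟩ := unit x
    refine ⟨((n : ℤ) : ℝ) / (1 : ℕ), ?_⟩
    rintro _ ⟨p, q, hq, h, rfl⟩
    exact hcmp x p n q 1 hq one_pos h (by simpa using hn)
  have hlow : ∀ (x : G) (p : ℤ) (q : ℕ), 0 < q → p • e - q • x ∈ N → (p / q : ℝ) ≤ sSup (lo x) :=
    fun x p q hq h => le_csSup (hbdd x) ⟨p, q, hq, h, rfl⟩
  have hne : ∀ x, (lo x).Nonempty := by
    intro x
    obtain ⟨n, hn⟩ := unit (-x)
    refine ⟨_, -(n : ℤ), 1, one_pos, ?_, rfl⟩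
    convert hn using 1
    simp only [neg_smul, natCast_zsmul, one_smul]
    abel
  have hup : ∀ (x : G) (p : ℤ) (q : ℕ), 0 < q → q • x - p • e ∈ N → sSup (lo x) ≤ (p / q : ℝ) := by
    intro x p q hq h
    refine csSup_le (hne x) ?_
    rintro _ ⟨p', q', hq', h', rfl⟩
    exact hcmp x p' p q' q hq' hq h' h
  -- integer approximation with a given denominator
  have hfloor : ∀ y : G, ∃ p : ℤ, p • e - y ∈ N ∧ y - (p + 1) • e ∈ N := by
    intro y
    obtain ⟨n, hn⟩ := unit y
    obtain ⟨m, hm⟩ := unit (-y)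
    obtain ⟨p, hp, hmax⟩ := Int.exists_greatest_of_bdd (P := fun p : ℤ => p • e - y ∈ N)
      ⟨n, fun z hz => by
        have := hmul (z - n) (by
          have := N.add_mem hz hn
          convert this using 1
          rw [sub_smul, natCast_zsmul]; abel)
        omega⟩
      ⟨-m, by
        convert hm using 1
        rw [neg_smul, natCast_zsmul]; abel⟩
    refine ⟨p, hp, ?_⟩
    rcases total ((p + 1) • e - y) with h | h
    · have := hmax _ h
      omega
    · simpa using h
  have hadd : ∀ x y, sSup (lo (x + y)) = sSup (lo x) + sSup (lo y) := by
    intro x y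
    have key : ∀ n : ℕ, n * |sSup (lo (x + y)) - (sSup (lo x) + sSup (lo y))| ≤ 2 := by
      intro n
      rcases Nat.eq_zero_or_pos n with rfl | hn
      · simp
      have hn' : (0 : ℝ) < n := by exact_mod_cast hn
      obtain ⟨p, hp, hp'⟩ := hfloor (n • x)
      obtain ⟨q, hq, hq'⟩ := hfloor (n • y)
      have a1 := hlow x p n hn hp
      have a2 := hup x (p + 1) n hn hp'
      have b1 := hlow y q n hn hq
      have b2 := hup y (q + 1) n hn hq'
      have c1 := hlow (x + y) (p + q) n hn (by
        convert N.add_mem hp hq using 1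
        rw [add_smul, smul_add]; abel)
      have c2 := hup (x + y) ((p + 1) + (q + 1)) n hn (by
        convert N.add_mem hp' hq' using 1
        rw [add_smul (p + 1), smul_add]; abel)
      rw [div_le_iff₀ hn'] at a1 b1 c1
      rw [le_div_iff₀ hn'] at a2 b2 c2
      push_cast at *
      rw [← abs_of_pos hn', ← abs_mul, abs_le]
      constructor <;> linarith
    by_contra hne
    have hpos : 0 < |sSup (lo (x + y)) - (sSup (lo x) + sSup (lo y))| :=
      abs_pos.2 (sub_ne_zero.2 hne)
    obtain ⟨n, hn⟩ := exists_nat_gt (2 / |sSup (lo (x + y)) - (sSup (lo x) + sSup (lo y))|)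
    rw [div_lt_iff₀ hpos] at hn
    exact absurd (key n) (not_le.2 hn)
  refine ⟨AddMonoidHom.mk' (fun x => sSup (lo x)) hadd, fun x hx => ?_, ?_⟩
  · simpa using hup x 0 1 one_pos (by simpa using hx)
  · exact le_antisymm (by simpa using hup e 1 1 one_pos (by simp))
      (by simpa using hlow e 1 1 one_pos (by simp))

/-! ### Lexicographic representation of order cones -/

section OrderCone

variable {M : Type*} [AddCommGroup M]

/-- The set `Q` of the elements `≤ 0` of a translation-invariant total preorder on `Γ × M` that
extends the order of `Γ ⊆ ℝ`. Prime congruences, flags up to local equivalence, prime filters and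
valuated monomial preorders are all classified by such sets. -/
structure IsOrderCone (Γ : AddSubgroup ℝ) (Q : Set (ℝ × M)) : Prop where
  fst_mem : ∀ a ∈ Q, a.1 ∈ Γ
  add_mem : ∀ a ∈ Q, ∀ b ∈ Q, a + b ∈ Q
  total : ∀ a : ℝ × M, a.1 ∈ Γ → a ∈ Q ∨ -a ∈ Q
  nonpos_mem : ∀ γ ∈ Γ, γ ≤ 0 → ((γ, 0) : ℝ × M) ∈ Q

namespace IsOrderCone

variable {Γ : AddSubgroup ℝ} {Q : Set (ℝ × M)}

theorem zero_mem (hQ : IsOrderCone Γ Q) : (0 : ℝ × M) ∈ Q :=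
  hQ.nonpos_mem 0 Γ.zero_mem le_rfl

/-- The elements `≤ 0` as a submonoid of a subgroup of `Γ × M`. -/
def submonoid (hQ : IsOrderCone Γ Q) (L : AddSubgroup (ℝ × M)) : AddSubmonoid L where
  carrier := {a | (a : ℝ × M) ∈ Q}
  zero_mem' := hQ.zero_mem
  add_mem' ha hb := hQ.add_mem _ ha _ hb

end IsOrderCone

/-- A monotone homomorphism from a subgroup of `ℝ` to `ℝ` is the multiplication by a constant. -/
theorem eq_mul_of_nonneg {L : AddSubgroup ℝ} (h : L →+ ℝ) (hh : ∀ γ : L, 0 ≤ (γ : ℝ) → 0 ≤ h γ)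
    (γ₀ : L) (hγ₀ : 0 < (γ₀ : ℝ)) (γ : L) : h γ = h γ₀ / γ₀ * γ := by
  set r := h γ₀ / γ₀ with hr
  have hr0 : r * γ₀ = h γ₀ := div_mul_cancel₀ _ hγ₀.ne'
  have key : ∀ n : ℕ, n * |h γ - r * γ| ≤ 2 * h γ₀ := by
    intro n
    set m := ⌊(n * γ / γ₀ : ℝ)⌋ with hm
    have h1 : (m : ℝ) * γ₀ ≤ n * γ := by
      rw [← le_div_iff₀ hγ₀]; exact Int.floor_le _
    have h2 : (n * γ : ℝ) ≤ (m + 1) * γ₀ := by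
      rw [← div_le_iff₀ hγ₀]; exact (Int.lt_floor_add_one _).le
    have a1 := hh (n • γ - m • γ₀) (by push_cast; simpa using h1)
    have a2 := hh ((m + 1) • γ₀ - n • γ) (by push_cast; simpa using h2)
    rw [map_sub, map_nsmul, map_zsmul, nsmul_eq_mul, zsmul_eq_mul] at a1 a2
    push_cast at a2
    have hr' : 0 ≤ r := div_nonneg (hh γ₀ hγ₀.le) hγ₀.le
    have b1 := mul_le_mul_of_nonneg_left h1 hr'
    have b2 := mul_le_mul_of_nonneg_left h2 hr'
    have c1 : r * (m * γ₀) = m * h γ₀ := by rw [← hr0]; ring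
    have c2 : r * ((m + 1) * γ₀) = m * h γ₀ + h γ₀ := by rw [← hr0]; ring
    rw [← Nat.abs_cast n, ← abs_mul, abs_le]
    constructor <;> nlinarith
  by_contra hne
  have hpos : 0 < |h γ - r * γ| := abs_pos.2 (sub_ne_zero.2 hne)
  obtain ⟨n, hn⟩ := exists_nat_gt (2 * h γ₀ / |h γ - r * γ|)
  rw [div_lt_iff₀ hpos] at hn
  exact absurd (key n) (not_le.2 hn)

/-- A homomorphism `h : L → ℝ` on a subgroup `L` of `ℝ × M` that is monotone on `L ∩ (ℝ × 0)` is the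
pairing with a point of `ℝ_{≥0} × N_ℝ`. -/
theorem exists_pairing_eq (L : AddSubgroup (ℝ × M)) (h : L →+ ℝ)
    (hh : ∀ a : L, (a : ℝ × M).2 = 0 → 0 ≤ (a : ℝ × M).1 → 0 ≤ h a) :
    ∃ w : RN M, 0 ≤ w.1 ∧ ∀ a : L, pairingLin (a : ℝ × M) w = h a := by
  obtain ⟨r, hr, hr'⟩ : ∃ r : ℝ, 0 ≤ r ∧
      ∀ a : L, (a : ℝ × M).2 = 0 → h a = r * (a : ℝ × M).1 := by
    by_cases hex : ∃ a : L, (a : ℝ × M).2 = 0 ∧ (a : ℝ × M).1 ≠ 0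
    · obtain ⟨a, ha, ha', hpos⟩ : ∃ a : L, (a : ℝ × M).2 = 0 ∧ (a : ℝ × M).1 ≠ 0 ∧
          0 < (a : ℝ × M).1 := by
        obtain ⟨a, ha, ha'⟩ := hex
        rcases lt_or_gt_of_ne ha' with hlt | hgt
        · exact ⟨-a, by simpa using ha, by simpa using ha', by simpa using hlt⟩
        · exact ⟨a, ha, ha', hgt⟩
      let ι : ℝ →+ ℝ × M := AddMonoidHom.inl ℝ M
      let g : (L.comap ι) →+ ℝ := h.comp ((ι.comp (L.comap ι).subtype).codRestrict L fun γ => γ.2)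
      have hg : ∀ b : L, ∀ hb : (b : ℝ × M).2 = 0, ∃ hm : (b : ℝ × M).1 ∈ L.comap ι,
          h b = g ⟨(b : ℝ × M).1, hm⟩ := by
        intro b hb
        have hb' : ((b : ℝ × M).1, (0 : M)) = b := Prod.ext rfl hb.symm
        have hm : (b : ℝ × M).1 ∈ L.comap ι := by
          change ((b : ℝ × M).1, (0 : M)) ∈ L
          rw [hb']; exact b.2
        exact ⟨hm, congrArg h (Subtype.ext hb'.symm)⟩
      obtain ⟨hm, hga⟩ := hg a ha
      have hnn : ∀ γ : L.comap ι, 0 ≤ (γ : ℝ) → 0 ≤ g γ := fun γ hγ => hh ⟨ι γ, γ.2⟩ rfl hγ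
      refine ⟨g ⟨_, hm⟩ / (a : ℝ × M).1, div_nonneg (hnn _ hpos.le) hpos.le, fun b hb => ?_⟩
      obtain ⟨hmb, hgb⟩ := hg b hb
      rw [hgb]
      exact eq_mul_of_nonneg g hnn ⟨_, hm⟩ hpos ⟨_, hmb⟩
    · push Not at hex
      refine ⟨0, le_rfl, fun a ha => ?_⟩
      have : a = 0 := Subtype.ext (Prod.ext (hex a ha) ha)
      rw [this]; simp
  let p : L →+ M := (AddMonoidHom.snd ℝ M).comp L.subtype
  let g : L →+ ℝ := h - (AddMonoidHom.mulLeft r).comp ((AddMonoidHom.fst ℝ M).comp L.subtype)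
  have hg : p.ker ≤ g.ker := fun a ha => by
    change h a - r * (a : ℝ × M).1 = 0
    rw [hr' a ha, sub_self]
  -- `ℝ` is divisible, hence an injective abelian group
  obtain ⟨x, hx⟩ := (Module.Baer.of_divisible ℝ).extension_property_addMonoidHom
    (QuotientAddGroup.kerLift p) (QuotientAddGroup.kerLift_injective p)
    (QuotientAddGroup.lift p.ker g hg)
  refine ⟨(r, x), hr, fun a => ?_⟩
  have h1 : x (p a) = g a := DFunLike.congr_fun hx (a : L ⧸ p.ker)
  change r * (a : ℝ × M).1 + x (p a) = h a
  rw [h1]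
  change r * (a : ℝ × M).1 + (h a - r * (a : ℝ × M).1) = h a
  ring

end OrderCone

namespace IsOrderCone

variable {M : Type*} [AddCommGroup M] {Γ : AddSubgroup ℝ} {Q : Set (ℝ × M)}

/-- A subgroup of `Γ × M` has a strong unit: a sum of absolute values of lifts of generators of its
image in `M` and of one nonzero element of its intersection with the archimedean group `Γ × 0`. -/
theorem exists_strong_unit [Module.Finite ℤ M] (hQ : IsOrderCone Γ Q) (L : AddSubgroup (ℝ × M))
    (hL : ∀ a ∈ L, a.1 ∈ Γ) :
    ∃ e : L, -e ∈ hQ.submonoid L ∧ ∀ x : L, ∃ n : ℕ, x - n • e ∈ hQ.submonoid L := by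
  classical
  set N := hQ.submonoid L with hN
  have total : ∀ x : L, x ∈ N ∨ -x ∈ N := fun x => hQ.total x (hL x x.2)
  have habs : ∀ x : L, ∃ y : L, -y ∈ N ∧ x - y ∈ N ∧ -x - y ∈ N := by
    intro x
    rcases total x with h | h
    · refine ⟨-x, by simpa using h, ?_, by simp⟩
      have := N.add_mem h h
      simpa using this
    · refine ⟨x, h, by simp, ?_⟩
      have := N.add_mem h h
      simpa [sub_eq_add_neg] using this
  choose ab hab hab1 hab2 using habs
  let p : L →+ M := (AddMonoidHom.snd ℝ M).comp L.subtype
  obtain ⟨s, hs⟩ : ∃ s : Finset p.range, AddSubgroup.closure (s : Set p.range) = ⊤ :=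
    ((AddGroup.fg_def).1 (Module.Finite.iff_addGroup_fg.1 (inferInstance :
      Module.Finite ℤ (AddSubgroup.toIntSubmodule p.range))))
  let l : p.range → L := fun y => y.2.choose
  have hl : ∀ y, p (l y) = y := fun y => y.2.choose_spec
  obtain ⟨g, hg⟩ : ∃ g : L, ∀ x : L, p x = 0 → ∃ n : ℕ, x - n • ab g ∈ N := by
    by_cases hex : ∃ a : L, p a = 0 ∧ (a : ℝ × M).1 ≠ 0
    · obtain ⟨g, hg, hg'⟩ := hex
      refine ⟨g, fun x hx => ?_⟩
      obtain ⟨n, hn⟩ := Archimedean.arch (x : ℝ × M).1 (abs_pos.2 hg')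
      refine ⟨n, ?_⟩
      -- `x ≤ n |g|` already holds in `Γ × 0`
      obtain ⟨y, hy, hyg, hyN⟩ : ∃ y : L, (x : ℝ × M).1 ≤ (n • y : ℝ × M).1 ∧ p y = 0 ∧
          y - ab g ∈ N := by
        rcases abs_choice (g : ℝ × M).1 with h | h
        · exact ⟨g, by rw [h] at hn; exact hn, hg, hab1 g⟩
        · exact ⟨-g, by rw [h] at hn; exact hn, by rw [map_neg, hg, neg_zero], hab2 g⟩
      have h1 : x - n • y ∈ N := by
        have h2 : p (x - n • y) = 0 := by rw [map_sub, map_nsmul, hx, hyg, smul_zero, sub_zero]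
        have h3 : ((x - n • y : L) : ℝ × M) = ((x : ℝ × M).1 - (n • y : ℝ × M).1, 0) :=
          Prod.ext rfl h2
        change ((x - n • y : L) : ℝ × M) ∈ Q
        rw [h3]
        refine hQ.nonpos_mem _ ?_ (sub_nonpos.2 hy)
        exact hL _ (x - n • y).2
      have := N.add_mem h1 (N.nsmul_mem hyN n)
      rwa [smul_sub, sub_add_sub_cancel] at this
    · push Not at hex
      refine ⟨0, fun x hx => ⟨0, ?_⟩⟩
      have : x = 0 := Subtype.ext (Prod.ext (hex x hx) hx)
      rw [this]; simp
  let e : L := ∑ y ∈ s, ab (l y) + ab g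
  have he1 : -∑ y ∈ s, ab (l y) ∈ N := by
    rw [← Finset.sum_neg_distrib]
    exact N.sum_mem fun y _ => hab _
  have he : -e ∈ N := by
    rw [neg_add]
    exact N.add_mem he1 (hab g)
  have hge : ab g - e ∈ N := by simpa [e] using he1
  have hse : ∀ y ∈ s, ab (l y) - e ∈ N := by
    intro y hy
    have h1 : ab (l y) - e = ∑ z ∈ s.erase y, -ab (l z) + -ab g := by
      simp only [e]
      rw [← Finset.add_sum_erase s (fun y => ab (l y)) hy, Finset.sum_neg_distrib]
      abel
    rw [h1]
    exact N.add_mem (N.sum_mem fun z _ => hab _) (hab g)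
  have mono : ∀ {x y : L} {n : ℕ}, x - n • y ∈ N → y - e ∈ N → x - n • e ∈ N := by
    intro x y n h h'
    have := N.add_mem h (N.nsmul_mem h' n)
    rwa [smul_sub, sub_add_sub_cancel] at this
  -- the elements bounded by multiples of `e` form a subgroup
  let B : AddSubgroup L :=
    { carrier := {x | (∃ n : ℕ, x - n • e ∈ N) ∧ ∃ n : ℕ, -x - n • e ∈ N}
      zero_mem' := ⟨⟨0, by simp⟩, 0, by simp⟩
      add_mem' := by
        rintro x y ⟨⟨n, hn⟩, m, hm⟩ ⟨⟨n', hn'⟩, m', hm'⟩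
        refine ⟨⟨n + n', ?_⟩, m + m', ?_⟩
        · convert N.add_mem hn hn' using 1
          rw [add_smul]; abel
        · convert N.add_mem hm hm' using 1
          rw [add_smul]; abel
      neg_mem' := by
        rintro x ⟨h, h'⟩
        exact ⟨h', by simpa using h⟩ }
  have hker : ∀ x : L, p x = 0 → x ∈ B := by
    intro x hx
    obtain ⟨n, hn⟩ := hg x hx
    obtain ⟨m, hm⟩ := hg (-x) (by rw [map_neg, hx, neg_zero])
    exact ⟨⟨n, mono hn hge⟩, m, mono hm hge⟩
  have hsB : ∀ y ∈ s, l y ∈ B := by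
    intro y hy
    refine ⟨⟨1, mono ?_ (hse y hy)⟩, 1, mono ?_ (hse y hy)⟩
    · simpa using hab1 (l y)
    · simpa using hab2 (l y)
  have hB : ∀ y : p.range, ∃ x ∈ B, p x = y := by
    intro y
    have hy : y ∈ AddSubgroup.closure (s : Set p.range) := by rw [hs]; trivial
    induction hy using AddSubgroup.closure_induction with
    | mem y hy => exact ⟨l y, hsB y hy, hl y⟩
    | zero => exact ⟨0, B.zero_mem, map_zero p⟩
    | add y z _ _ hy hz =>
      obtain ⟨x, hx, hxy⟩ := hy
      obtain ⟨x', hx', hxz⟩ := hz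
      exact ⟨x + x', B.add_mem hx hx', by rw [map_add, hxy, hxz]; rfl⟩
    | neg y _ hy =>
      obtain ⟨x, hx, hxy⟩ := hy
      exact ⟨-x, B.neg_mem hx, by rw [map_neg, hxy]; rfl⟩
  refine ⟨e, he, fun x => ?_⟩
  obtain ⟨y, hy, hxy⟩ := hB ⟨p x, x, rfl⟩
  have h1 : x - y ∈ B := hker _ (by rw [map_sub, hxy, sub_self])
  have h2 : x ∈ B := by simpa using B.add_mem h1 hy
  exact h2.1

/-- If the preorder is nontrivial on a subgroup of `Γ × M`, its coarsest nontrivial information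
there is the pairing with a point of `ℝ_{≥0} × N_ℝ`. -/
theorem exists_pairing [Module.Finite ℤ M] (hQ : IsOrderCone Γ Q) (L : AddSubgroup (ℝ × M))
    (hL : ∀ a ∈ L, a.1 ∈ Γ) (hLQ : ∃ a ∈ L, a ∉ Q) :
    ∃ w : RN M, 0 ≤ w.1 ∧ (∀ a ∈ L, a ∈ Q → pairingLin a w ≤ 0) ∧
      ∃ a ∈ L, pairingLin a w ≠ 0 := by
  obtain ⟨e, he, hunit⟩ := hQ.exists_strong_unit L hL
  have heN : e ∉ hQ.submonoid L := by
    intro he'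
    obtain ⟨a, ha, haQ⟩ := hLQ
    obtain ⟨n, hn⟩ := hunit ⟨a, ha⟩
    apply haQ
    have := (hQ.submonoid L).add_mem hn ((hQ.submonoid L).nsmul_mem he' n)
    rw [sub_add_cancel] at this
    exact this
  obtain ⟨h, hh, hhe⟩ := exists_monotone_addMonoidHom (hQ.submonoid L)
    (fun x => hQ.total x (hL x x.2)) heN hunit
  obtain ⟨w, hw, hwh⟩ := exists_pairing_eq L h fun a ha ha' => by
    have hmem : -a ∈ hQ.submonoid L := by
      change ((-a : L) : ℝ × M) ∈ Q
      have h1 : ((-a : L) : ℝ × M) = (-(a : ℝ × M).1, 0) := Prod.ext rfl (neg_eq_zero.2 ha)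
      rw [h1]
      exact hQ.nonpos_mem _ (Γ.neg_mem (hL a a.2)) (neg_nonpos.2 ha')
    have := hh _ hmem
    rw [map_neg] at this
    linarith
  refine ⟨w, hw, fun a ha haQ => ?_, e, e.2, ?_⟩
  · exact (hwh ⟨a, ha⟩).trans_le (hh ⟨a, ha⟩ haQ)
  · rw [hwh e, hhe]; exact one_ne_zero

end IsOrderCone

/-- The order cone of points `w_1, …, w_k`: the elements of `Γ × M` whose vector of pairings with
the `w_i` is lexicographically at most `0`. -/
def lexCone {M : Type*} [AddCommGroup M] (Γ : AddSubgroup ℝ) {k : ℕ} (w : Fin k → RN M) :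
    Set (ℝ × M) :=
  {a | a.1 ∈ Γ ∧ LexNonpos fun i => pairingLin a (w i)}

section Representation

variable {M : Type*} [AddCommGroup M] {Γ : AddSubgroup ℝ}

theorem isOrderCone_lexCone {k : ℕ} (w : Fin k → RN M) (hw : ∀ i, 0 ≤ (w i).1) :
    IsOrderCone Γ (lexCone Γ w) where
  fst_mem a ha := ha.1
  add_mem a ha b hb := by
    refine ⟨Γ.add_mem ha.1 hb.1, ?_⟩
    simp only [pairingLin_add]
    exact ha.2.add hb.2
  total a ha := by
    refine (LexNonpos.total fun i => pairingLin a (w i)).imp (fun h => ⟨ha, h⟩) fun h => ?_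
    refine ⟨Γ.neg_mem ha, ?_⟩
    simp only [pairingLin_neg]
    exact h
  nonpos_mem γ hγ hγ0 := by
    refine ⟨hγ, fun i _ => ?_⟩
    simpa [pairingLin_apply, pairing] using mul_nonpos_of_nonneg_of_nonpos (hw i) hγ0

instance NReal.instFiniteDimensional [Module.Free ℤ M] [Module.Finite ℤ M] :
    FiniteDimensional ℝ (NReal M) := by
  let b := Module.Free.chooseBasis ℤ M
  let f : NReal M →ₗ[ℝ] (Module.Free.ChooseBasisIndex ℤ M → ℝ) :=
    { toFun := fun x i => x (b i)
      map_add' := fun _ _ => rfl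
      map_smul' := fun _ _ => rfl }
  refine FiniteDimensional.of_injective f fun x y h => ?_
  have : x.toIntLinearMap = y.toIntLinearMap := b.ext fun i => congrFun h i
  ext m
  exact DFunLike.congr_fun this m

/-- Every order cone is the order cone of finitely many linearly independent points of
`ℝ_{≥0} × N_ℝ`: a longest possible list of points whose lexicographic order is coarser than the
given one must define it, since otherwise the preorder is nontrivial on the common kernel. -/
theorem IsOrderCone.exists_eq_lexCone [Module.Free ℤ M] [Module.Finite ℤ M] {Q : Set (ℝ × M)}
    (hQ : IsOrderCone Γ Q) :
    ∃ (k : ℕ) (w : Fin k → RN M), LinearIndependent ℝ w ∧ (∀ i, 0 ≤ (w i).1) ∧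
      Q = lexCone Γ w := by
  let Rep : ℕ → Prop := fun k => ∃ w : Fin k → RN M, LinearIndependent ℝ w ∧ (∀ i, 0 ≤ (w i).1) ∧
    Q ⊆ lexCone Γ w
  obtain ⟨k, ⟨w, hli, hw, hsub⟩, hmax⟩ : ∃ k, Rep k ∧ ¬ Rep (k + 1) := by
    by_contra! hcon
    have hall : ∀ k, Rep k := fun k => by
      induction k with
      | zero =>
        exact ⟨Fin.elim0, linearIndependent_empty_type, fun i => i.elim0,
          fun a ha => ⟨hQ.fst_mem a ha, fun i => i.elim0⟩⟩
      | succ k ih => exact hcon k ih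
    obtain ⟨w, hli, -⟩ := hall (Module.finrank ℝ (RN M) + 1)
    have := hli.fintype_card_le_finrank
    simp at this
  refine ⟨k, w, hli, hw, hsub.antisymm fun a ha => ?_⟩
  let L : AddSubgroup (ℝ × M) :=
    { carrier := {a | a.1 ∈ Γ ∧ ∀ i, pairingLin a (w i) = 0}
      zero_mem' := ⟨Γ.zero_mem, fun i => pairingLin_zero _⟩
      add_mem' := fun ha hb => ⟨Γ.add_mem ha.1 hb.1, fun i => by
        rw [pairingLin_add, ha.2, hb.2, add_zero]⟩
      neg_mem' := fun ha => ⟨Γ.neg_mem ha.1, fun i => by rw [pairingLin_neg, ha.2, neg_zero]⟩ }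
  have hLQ : ∀ a ∈ L, a ∈ Q := by
    by_contra! hcon
    obtain ⟨w', hw', hmono, b, hb, hb'⟩ := hQ.exists_pairing L (fun a ha => ha.1) hcon
    refine hmax ⟨Fin.snoc w w', ?_, ?_, ?_⟩
    · rw [linearIndependent_finSnoc]
      refine ⟨hli, fun hmem => hb' ?_⟩
      have hle : Submodule.span ℝ (Set.range w) ≤ LinearMap.ker (pairingLin b) := by
        rw [Submodule.span_le]
        rintro _ ⟨i, rfl⟩
        exact hb.2 i
      exact hle hmem
    · intro i
      induction i using Fin.lastCases with
      | last => simpa using hw'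
      | cast i => simpa using hw i
    · intro a ha
      refine ⟨hQ.fst_mem a ha, fun i hi => ?_⟩
      induction i using Fin.lastCases with
      | last =>
        have hz : ∀ i, pairingLin a (w i) = 0 := fun i => by
          simpa using hi i.castSucc (Fin.castSucc_lt_last i)
        simpa using hmono a ⟨hQ.fst_mem a ha, hz⟩ ha
      | cast i =>
        have := (hsub ha).2 i fun j hj => by
          simpa using hi j.castSucc (Fin.castSucc_lt_castSucc_iff.2 hj)
        simpa using this
  rcases hQ.total a ha.1 with h | h
  · exact h
  · have h0 := ha.2.eq_zero (by
      have := (hsub h).2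
      simp only [pairingLin_neg] at this
      exact this)
    exact hLQ a ⟨ha.1, fun i => congrFun h0 i⟩

end Representation

/-! ### Prime congruences and order cones -/

/-- In a commutative monoid whose canonical relation `a + b = b` is total, a finite sum is bounded
by `c` if and only if its summands are. -/
theorem sum_add_eq_iff {R ι : Type*} [AddCommMonoid R] (htot : ∀ a b : R, a + b = b ∨ b + a = a)
    (s : Finset ι) (f : ι → R) (c : R) : ∑ i ∈ s, f i + c = c ↔ ∀ i ∈ s, f i + c = c := by
  classical
  induction s using Finset.induction_on with
  | empty => simp
  | insert i s hi ih =>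
    rw [Finset.sum_insert hi, Finset.forall_mem_insert, ← ih]
    have hidem : ∀ a : R, a + a = a := fun a => (htot a a).elim id id
    constructor
    · intro h
      constructor
      · rw [← h, ← add_assoc, ← add_assoc, hidem]
      · calc ∑ x ∈ s, f x + c = ∑ x ∈ s, f x + (f i + ∑ x ∈ s, f x + c) := by rw [h]
          _ = f i + ∑ x ∈ s, f x + c := by
            rw [add_comm (f i), ← add_assoc, ← add_assoc, hidem]
          _ = c := h
    · rintro ⟨h, h'⟩
      rw [add_assoc, h', h]

/-- In a commutative monoid whose canonical relation `a + b = b` is total, a nonempty finite sum is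
one of its summands. -/
theorem exists_sum_eq {R ι : Type*} [AddCommMonoid R] (htot : ∀ a b : R, a + b = b ∨ b + a = a)
    {s : Finset ι} (hs : s.Nonempty) (f : ι → R) : ∃ i ∈ s, ∑ i ∈ s, f i = f i := by
  classical
  induction hs using Finset.Nonempty.cons_induction with
  | singleton i => exact ⟨i, by simp, by simp⟩
  | cons i s hi hs ih =>
    obtain ⟨j, hj, hsum⟩ := ih
    rw [Finset.sum_cons, hsum]
    rcases htot (f i) (f j) with h | h
    · exact ⟨j, Finset.mem_cons_of_mem hj, h⟩
    · exact ⟨i, Finset.mem_cons_self i s, by rw [add_comm]; exact h⟩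

/-- The value group of a sub-semifield, as a subgroup of `ℝ`. -/
def valueSubgroup (S : Subsemiring TropReal) (hS : IsSubsemifield S) : AddSubgroup ℝ where
  carrier := valueGroup S
  zero_mem' := S.one_mem
  add_mem' ha hb := S.mul_mem ha hb
  neg_mem' {γ} hγ := by
    obtain ⟨b, hb, h⟩ := hS _ hγ (MaxPlus.tPow_ne_zero γ)
    have h1 : MaxPlus.tPow γ * MaxPlus.tPow (-γ) = (1 : TropReal) := by
      rw [← MaxPlus.tPow_add, add_neg_cancel, MaxPlus.tPow_zero]
    rw [← h] at h1
    have h2 := MaxPlus.mul_left_cancel₀ (MaxPlus.tPow_ne_zero γ) h1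
    change MaxPlus.tPow (-γ) ∈ S
    rw [h2]
    exact hb

section Prime

variable {M : Type*} [AddCommGroup M] {S : Subsemiring TropReal}

/-- The term `t^γ χ^u` of `S[M]` for `γ ∈ Γ` and `u ∈ M`. -/
noncomputable def term (a : ℝ × M) (ha : a.1 ∈ valueGroup S) : AddMonoidAlgebra S M :=
  AddMonoidAlgebra.single a.2 ⟨MaxPlus.tPow a.1, ha⟩

theorem term_mul_term (hS : IsSubsemifield S) (a b : ℝ × M) (ha : a.1 ∈ valueGroup S)
    (hb : b.1 ∈ valueGroup S) :
    term a ha * term b hb = term (a + b) ((valueSubgroup S hS).add_mem ha hb) := by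
  unfold term
  rw [AddMonoidAlgebra.single_mul_single]
  rfl

theorem term_zero : term (0 : ℝ × M) S.one_mem = 1 := rfl

theorem log_coeff_mem {M : Type*} (f : AddMonoidAlgebra S M) {u : M} (hu : u ∈ f.coeff.support) :
    TropReal.log (f.coeff u) ∈ valueGroup S := by
  have h : ((f.coeff u : S) : TropReal) ≠ 0 := fun h =>
    Finsupp.mem_support_iff.1 hu (Subtype.ext h)
  change MaxPlus.tPow _ ∈ S
  rw [TropReal.tPow_log h]
  exact (f.coeff u).2

theorem term_log_coeff {M : Type*} (f : AddMonoidAlgebra S M) {u : M} (hu : u ∈ f.coeff.support) :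
    term (TropReal.log (f.coeff u), u) (log_coeff_mem f hu) =
      AddMonoidAlgebra.single u (f.coeff u) := by
  have h : ((f.coeff u : S) : TropReal) ≠ 0 := fun h =>
    Finsupp.mem_support_iff.1 hu (Subtype.ext h)
  rw [term]
  congr 1
  exact Subtype.ext (TropReal.tPow_log h)

theorem eq_sum_term {M : Type*} (f : AddMonoidAlgebra S M) :
    f = ∑ u ∈ f.coeff.support.attach,
      term (TropReal.log (f.coeff u), (u : M)) (log_coeff_mem f u.2) := by
  rw [Finset.sum_congr rfl fun u _ => term_log_coeff f u.2]
  rw [Finset.sum_attach f.coeff.support fun u => AddMonoidAlgebra.single u (f.coeff u)]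
  exact (AddMonoidAlgebra.sum_coeff_single f).symm

variable {P : RingCon (AddMonoidAlgebra S M)}

theorem leAt_trans {A : Type*} [CommSemiring A] {P : RingCon A} {f g h : A}
    (hfg : P.leAt f g) (hgh : P.leAt g h) : P.leAt f h := by
  unfold RingCon.leAt at *
  rw [← hgh, ← add_assoc, hfg]

theorem IsPrimeCongruence.leAt_refl {A : Type*} [CommSemiring A] {P : RingCon A}
    (hP : IsPrimeCongruence P) (f : A) : P.leAt f f :=
  (hP.total f f).elim id id

theorem IsPrimeCongruence.iff_leAt {A : Type*} [CommSemiring A] {P : RingCon A}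
    (hP : IsPrimeCongruence P) (f g : A) : P f g ↔ P.leAt f g ∧ P.leAt g f := by
  rw [← RingCon.eq]
  constructor
  · intro h
    have := hP.leAt_refl f
    unfold RingCon.leAt at *
    rw [← h]
    exact ⟨this, this⟩
  · rintro ⟨h, h'⟩
    unfold RingCon.leAt at h h'
    rw [← h, add_comm, h']

theorem leAt_mul {A : Type*} [CommSemiring A] {P : RingCon A} {f g : A} (h : A)
    (hfg : P.leAt f g) : P.leAt (f * h) (g * h) := by
  unfold RingCon.leAt at *
  rw [RingCon.coe_mul, RingCon.coe_mul, ← add_mul, hfg]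

/-- Terms are units, hence nonzero modulo a proper congruence. -/
theorem IsPrimeCongruence.not_leAt_term_zero (hS : IsSubsemifield S) (hP : IsPrimeCongruence P)
    (a : ℝ × M) (ha : a.1 ∈ valueGroup S) : ¬ P.leAt (term a ha) 0 := by
  intro h
  have ha' : (-a).1 ∈ valueGroup S := (valueSubgroup S hS).neg_mem ha
  have h1 := leAt_mul (term (-a) ha') h
  rw [term_mul_term hS, zero_mul] at h1
  simp only [add_neg_cancel] at h1
  rw [term_zero] at h1
  unfold RingCon.leAt at h1
  rw [RingCon.coe_zero, add_zero, RingCon.coe_one] at h1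
  apply hP.proper
  rw [← RingCon.eq]
  exact h1.symm

/-- The order cone of a congruence: the pairs `(γ, u)` with `t^γ χ^u ≤_P 1`. -/
def termCone (P : RingCon (AddMonoidAlgebra S M)) : Set (ℝ × M) :=
  {a | ∃ ha : a.1 ∈ valueGroup S, P.leAt (term a ha) 1}

theorem leAt_term_iff (hS : IsSubsemifield S) (a b : ℝ × M) (ha : a.1 ∈ valueGroup S)
    (hb : b.1 ∈ valueGroup S) :
    P.leAt (term a ha) (term b hb) ↔ a - b ∈ termCone P := by
  have hb' : (-b).1 ∈ valueGroup S := (valueSubgroup S hS).neg_mem hb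
  constructor
  · intro h
    have h1 := leAt_mul (term (-b) hb') h
    rw [term_mul_term hS _ _ ha, term_mul_term hS _ _ hb] at h1
    simp only [add_neg_cancel] at h1
    rw [term_zero] at h1
    rw [sub_eq_add_neg]
    exact ⟨_, h1⟩
  · rintro ⟨h, h'⟩
    have h1 := leAt_mul (term b hb) h'
    rw [term_mul_term hS _ _ h, one_mul] at h1
    simpa only [sub_add_cancel] using h1

/-- The order of `S[M] / P` extends the order of `Γ`. -/
theorem leAt_term_of_le (γ δ : ℝ) (hle : γ ≤ δ)
    (hγ : γ ∈ valueGroup S) (hδ : δ ∈ valueGroup S) (u : M) :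
    P.leAt (term (γ, u) hγ) (term (δ, u) hδ) := by
  have h : term (γ, u) hγ + term (δ, u) hδ = term (δ, u) hδ := by
    rw [term, term, ← AddMonoidAlgebra.single_add]
    congr 1
    exact Subtype.ext ((MaxPlus.tPow_add_tPow_eq_right_iff γ δ).2 hle)
  unfold RingCon.leAt
  rw [← RingCon.coe_add, h]

theorem IsPrimeCongruence.isOrderCone (hS : IsSubsemifield S) (hP : IsPrimeCongruence P) :
    IsOrderCone (valueSubgroup S hS) (termCone P) where
  fst_mem a ha := ha.1
  add_mem a ha b hb := by
    obtain ⟨ha, ha'⟩ := ha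
    obtain ⟨hb, hb'⟩ := hb
    refine ⟨(valueSubgroup S hS).add_mem ha hb, ?_⟩
    rw [← term_mul_term hS a b ha hb]
    refine leAt_trans (leAt_mul _ ha') ?_
    rwa [one_mul]
  total a ha := by
    have h0 := leAt_term_iff hS (P := P) a 0 ha (valueSubgroup S hS).zero_mem
    have h1 := leAt_term_iff hS (P := P) 0 a (valueSubgroup S hS).zero_mem ha
    rw [sub_zero] at h0
    rw [zero_sub] at h1
    rw [← h0, ← h1]
    exact hP.total _ _
  nonpos_mem γ hγ hγ0 := ⟨hγ, leAt_term_of_le γ 0 hγ0 hγ (valueSubgroup S hS).zero_mem 0⟩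

/-- The order of `S[M] / P` is determined by its restriction to terms. -/
theorem IsPrimeCongruence.leAt_iff (hS : IsSubsemifield S) (hP : IsPrimeCongruence P)
    (f g : AddMonoidAlgebra S M) :
    P.leAt f g ↔ ∀ u ∈ f.coeff.support, ∃ v ∈ g.coeff.support,
      (TropReal.log (f.coeff u), u) - (TropReal.log (g.coeff v), v) ∈ termCone P := by
  have hf : P.leAt f g ↔ ∀ u : f.coeff.support,
      P.leAt (term (TropReal.log (f.coeff u), (u : M)) (log_coeff_mem f u.2)) g := by
    conv_lhs => rw [eq_sum_term f]
    unfold RingCon.leAt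
    rw [← RingCon.coe_mk', map_sum, sum_add_eq_iff hP.total]
    simp
  rw [hf, Subtype.forall]
  refine forall₂_congr fun u hu => ?_
  constructor
  · intro h
    rcases g.coeff.support.attach.eq_empty_or_nonempty with he | hne
    · rw [eq_sum_term g, he, Finset.sum_empty] at h
      exact absurd h (hP.not_leAt_term_zero hS _ _)
    · obtain ⟨v, -, hv⟩ := exists_sum_eq hP.total hne fun v => P.mk'
        (term (TropReal.log (g.coeff v), (v : M)) (log_coeff_mem g v.2))
      rw [← map_sum, ← eq_sum_term] at hv
      refine ⟨v, v.2, ?_⟩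
      rw [← leAt_term_iff hS _ _ (log_coeff_mem f hu) (log_coeff_mem g v.2)]
      unfold RingCon.leAt at h ⊢
      rw [← RingCon.coe_mk', ← hv]
      exact h
  · rintro ⟨v, hv, h⟩
    rw [← leAt_term_iff hS _ _ (log_coeff_mem f hu) (log_coeff_mem g hv)] at h
    refine leAt_trans h ?_
    have hg : P.leAt g g := hP.leAt_refl g
    nth_rw 1 [eq_sum_term g] at hg
    unfold RingCon.leAt at hg ⊢
    rw [← RingCon.coe_mk', map_sum, sum_add_eq_iff hP.total] at hg
    exact hg ⟨v, hv⟩ (Finset.mem_attach _ _)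

theorem IsPrimeCongruence.eq_of_termCone_eq (hS : IsSubsemifield S)
    {P P' : RingCon (AddMonoidAlgebra S M)} (hP : IsPrimeCongruence P)
    (hP' : IsPrimeCongruence P') (h : termCone P = termCone P') : P = P' := by
  ext f g
  rw [hP.iff_leAt, hP'.iff_leAt, hP.leAt_iff hS, hP.leAt_iff hS, hP'.leAt_iff hS,
    hP'.leAt_iff hS, h]

/-! ### Congruences of points -/

variable {k : ℕ}

theorem isPrimeCongruence_congOfPoints (w : Fin k → RN M) (hw : ∀ i, 0 ≤ (w i).1) :
    IsPrimeCongruence (congOfPoints S w hw) where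
  proper h := by
    have h1 : phi S w hw 0 = phi S w hw 1 := h
    rw [map_zero, map_one] at h1
    exact zero_ne_one h1
  total a b := by
    obtain ⟨f, rfl⟩ := RingCon.mk'_surjective (congOfPoints S w hw) a
    obtain ⟨g, rfl⟩ := RingCon.mk'_surjective (congOfPoints S w hw) b
    rw [← map_add, ← map_add]
    refine (MaxPlus.add_total (phi S w hw f) (phi S w hw g)).imp (fun h => ?_) fun h => ?_
    · exact (RingCon.eq _).2 ((map_add (phi S w hw) f g).trans h)
    · exact (RingCon.eq _).2 ((map_add (phi S w hw) g f).trans h)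
  cancel a b c ha h := by
    obtain ⟨f, rfl⟩ := RingCon.mk'_surjective (congOfPoints S w hw) a
    obtain ⟨g, rfl⟩ := RingCon.mk'_surjective (congOfPoints S w hw) b
    obtain ⟨g', rfl⟩ := RingCon.mk'_surjective (congOfPoints S w hw) c
    rw [← map_mul, ← map_mul] at h
    have h1 : phi S w hw (f * g) = phi S w hw (f * g') := (RingCon.eq _).1 h
    rw [map_mul, map_mul] at h1
    have hf : phi S w hw f ≠ 0 := fun h0 =>
      ha ((RingCon.eq _).2 (h0.trans (map_zero (phi S w hw)).symm))
    exact (RingCon.eq _).2 (MaxPlus.mul_left_cancel₀ hf h1)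

theorem termCone_congOfPoints (hS : IsSubsemifield S) (w : Fin k → RN M) (hw : ∀ i, 0 ≤ (w i).1) :
    termCone (congOfPoints S w hw) = lexCone (valueSubgroup S hS) w := by
  have key : ∀ (a : ℝ × M) (ha : a.1 ∈ valueGroup S), (congOfPoints S w hw).leAt (term a ha) 1 ↔
      LexNonpos fun i => pairingLin a (w i) := fun a ha => by
    have h1 : (congOfPoints S w hw).leAt (term a ha) 1 ↔
        phi S w hw (term a ha) + phi S w hw 1 = phi S w hw 1 := by
      unfold RingCon.leAt
      rw [← RingCon.coe_add, RingCon.eq, ← map_add]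
      exact Iff.rfl
    rw [h1, term, phi_single, map_one, ← MaxPlus.tPow_zero, MaxPlus.tPow_add_tPow_eq_right_iff,
      lexNonpos_iff]
    exact Iff.rfl
  ext a
  exact ⟨fun ⟨ha, h⟩ => ⟨ha, (key a ha).1 h⟩, fun ⟨ha, h⟩ => ⟨ha, (key a ha).2 h⟩⟩

end Prime

/-- The set of order cones in `Γ × M`. -/
def OrderCone (Γ : AddSubgroup ℝ) (M : Type*) [AddCommGroup M] :=
  {Q : Set (ℝ × M) // IsOrderCone Γ Q}

/-- Prime congruences on `S[M]` correspond to order cones in `Γ × M`. -/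
noncomputable def primeEquiv (M : Type*) [AddCommGroup M] [Module.Free ℤ M] [Module.Finite ℤ M]
    (S : Subsemiring TropReal) (hS : IsSubsemifield S) :
    PrimeCongruence (AddMonoidAlgebra S M) ≃ OrderCone (valueSubgroup S hS) M :=
  Equiv.ofBijective (fun P => ⟨termCone P.1, P.2.isOrderCone hS⟩)
    ⟨fun P P' h => Subtype.ext (P.2.eq_of_termCone_eq hS P'.2 (congrArg Subtype.val h)),
      fun ⟨Q, hQ⟩ => by
        obtain ⟨k, w, -, hw, rfl⟩ := hQ.exists_eq_lexCone
        exact ⟨⟨congOfPoints S w hw, isPrimeCongruence_congOfPoints w hw⟩,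
          Subtype.ext (termCone_congOfPoints hS w hw)⟩⟩

/-! ### Relative interiors of finitely generated cones -/

section Topology

variable {M : Type*} [AddCommGroup M]

/-- Evaluation of homomorphisms as a linear map, which induces the topology of `N_ℝ`. -/
def NReal.evalLin (M : Type*) [AddCommGroup M] : NReal M →ₗ[ℝ] (M → ℝ) where
  toFun x u := x u
  map_add' _ _ := rfl
  map_smul' _ _ := rfl

instance NReal.instIsTopologicalAddGroup : IsTopologicalAddGroup (NReal M) :=
  topologicalAddGroup_induced (NReal.evalLin M)

instance NReal.instContinuousSMul : ContinuousSMul ℝ (NReal M) :=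
  continuousSMul_induced (NReal.evalLin M)

instance NReal.instT2Space : T2Space (NReal M) :=
  T2Space.of_injective_continuous (f := NReal.evalLin M) (fun _ _ h => DFunLike.coe_injective h)
    continuous_induced_dom

end Topology

section RelativeInterior

variable {V : Type*} [AddCommGroup V] [Module ℝ V]

/-- A finitely generated cone contains a point from which a positive multiple of any other point of
the cone can be subtracted, namely the sum of its generators. -/
theorem PointedCone.exists_forall_sub_smul_mem_of_fg {C : PointedCone ℝ V} (hC : C.FG) :
    ∃ x ∈ C, ∀ p ∈ C, ∃ ε : ℝ, 0 < ε ∧ x - ε • p ∈ C := by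
  obtain ⟨s, rfl⟩ := hC
  set C := Submodule.span {r : ℝ // 0 ≤ r} (s : Set V) with hC
  have hs : ∀ y ∈ s, y ∈ C := fun y hy => Submodule.subset_span hy
  have hsum : ∑ y ∈ s, y ∈ C := C.sum_mem hs
  refine ⟨∑ y ∈ s, y, hsum, fun p hp => ?_⟩
  rw [hC] at hp
  induction hp using Submodule.span_induction with
  | mem y hy =>
    refine ⟨1, one_pos, ?_⟩
    classical
    rw [one_smul, ← Finset.add_sum_erase s (fun y => y) hy, add_sub_cancel_left]
    exact C.sum_mem fun z hz => hs z (Finset.mem_of_mem_erase hz)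
  | zero => exact ⟨1, one_pos, by simpa using hsum⟩
  | add p q _ _ hp hq =>
    obtain ⟨ε, hε, h⟩ := hp
    obtain ⟨δ, hδ, h'⟩ := hq
    -- average the two points after scaling to the common step `ε δ / (ε + δ)`
    refine ⟨ε * δ / (ε + δ), by positivity, ?_⟩
    have h1 := C.add_mem (PointedCone.smul_mem C (show 0 ≤ δ / (ε + δ) by positivity) h)
      (PointedCone.smul_mem C (show 0 ≤ ε / (ε + δ) by positivity) h')
    convert h1 using 1
    match_scalars <;> (field_simp; try ring)
  | smul r p _ hp =>
    obtain ⟨ε, hε, h⟩ := hp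
    rcases r.2.eq_or_lt with h0 | h0
    · refine ⟨1, one_pos, ?_⟩
      have : r • p = (r : ℝ) • p := rfl
      rw [this, ← h0]
      simpa using hsum
    · refine ⟨ε / r, by positivity, ?_⟩
      have : r • p = (r : ℝ) • p := rfl
      rw [this, smul_smul, div_mul_cancel₀ _ h0.ne']
      exact h

variable [TopologicalSpace V]

/-- A relative interior point of a cone stays in the cone after subtracting a small multiple of any
point of the cone. -/
theorem sub_smul_mem_of_mem_intrinsicInterior [IsTopologicalAddGroup V] [ContinuousSMul ℝ V]
    {C : PointedCone ℝ V} {x : V} (hx : x ∈ intrinsicInterior ℝ (C : Set V)) {p : V}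
    (hp : p ∈ C) : ∃ ε : ℝ, 0 < ε ∧ x - ε • p ∈ C := by
  obtain ⟨y, hy, rfl⟩ := mem_intrinsicInterior.1 hx
  have hmem : ∀ ε : ℝ, (y : V) - ε • p ∈ affineSpan ℝ (C : Set V) := fun ε => by
    have h1 := AffineSubspace.vadd_mem_of_mem_direction (s := affineSpan ℝ (C : Set V))
      (v := -(ε • p)) ?_ y.2
    · simpa [sub_eq_neg_add] using h1
    · refine Submodule.neg_mem _ (Submodule.smul_mem _ _ ?_)
      have h2 := AffineSubspace.vsub_mem_direction (subset_affineSpan ℝ (C : Set V) hp)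
        (subset_affineSpan ℝ (C : Set V) C.zero_mem)
      simpa using h2
  let f : ℝ → affineSpan ℝ (C : Set V) := fun ε => ⟨y - ε • p, hmem ε⟩
  have hf : Continuous f := by
    refine Continuous.subtype_mk ?_ _
    fun_prop
  have hf0 : f 0 = y := Subtype.ext (by simp [f])
  have hnhds : ∀ᶠ ε in nhdsWithin (0 : ℝ) (Set.Ioi 0), f ε ∈
      ((↑) ⁻¹' (C : Set V) : Set (affineSpan ℝ (C : Set V))) := by
    refine nhdsWithin_le_nhds (hf.continuousAt.eventually_mem ?_)
    rw [hf0]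
    exact mem_interior_iff_mem_nhds.1 hy
  obtain ⟨ε, hε, hpos⟩ := (hnhds.and self_mem_nhdsWithin).exists
  exact ⟨ε, hpos, hε⟩

/-- A point of a cone in a finite-dimensional space is in the relative interior if a positive
multiple of any point of the cone can be subtracted from it without leaving the cone. -/
theorem mem_intrinsicInterior_of_forall_sub_smul_mem [IsTopologicalAddGroup V]
    [ContinuousSMul ℝ V] [T2Space V] [FiniteDimensional ℝ V] {C : PointedCone ℝ V} {x : V}
    (hxC : x ∈ C) (hx : ∀ p ∈ C, ∃ ε : ℝ, 0 < ε ∧ x - ε • p ∈ C) :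
    x ∈ intrinsicInterior ℝ (C : Set V) := by
  classical
  -- a basis of the span of `C` consisting of points of `C`
  obtain ⟨B, hBC, hBspan, hBli⟩ := exists_linearIndependent ℝ (C : Set V)
  have hBspan' : Submodule.span ℝ (Set.range ((↑) : B → V)) = Submodule.span ℝ (C : Set V) := by
    rw [Subtype.range_coe, hBspan]
  have : Fintype B := (LinearIndependent.setFinite hBli).fintype
  let b := Module.Basis.span hBli
  choose g hg using fun j => LinearMap.exists_extend (b.coord j)
  have hsum : ∀ z ∈ Submodule.span ℝ (C : Set V), ∑ j, g j z • (j : V) = z := by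
    intro z hz
    rw [← hBspan'] at hz
    have h1 := congrArg Subtype.val (b.sum_repr ⟨z, hz⟩)
    rw [Submodule.coe_sum] at h1
    conv_rhs => rw [← show _ = z from h1]
    refine Finset.sum_congr rfl fun j _ => ?_
    have h2 : g j z = b.repr ⟨z, hz⟩ j := LinearMap.congr_fun (hg j) ⟨z, hz⟩
    rw [h2, Submodule.coe_smul]
    congr 1
    exact congrArg Subtype.val (Module.Basis.span_apply hBli j).symm
  obtain ⟨ε, hε, hxε⟩ := hx (∑ j : B, (j : V)) (C.sum_mem fun j _ => hBC j.2)
  have hxaff := subset_affineSpan ℝ (C : Set V) hxC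
  refine mem_intrinsicInterior.2 ⟨⟨x, hxaff⟩, mem_interior_iff_mem_nhds.2 ?_, rfl⟩
  have hev : ∀ᶠ z : affineSpan ℝ (C : Set V) in nhds ⟨x, hxaff⟩, ∀ j, -ε < g j ((z : V) - x) := by
    refine Filter.eventually_all.2 fun j => ?_
    have hgc : Continuous (g j) := LinearMap.continuous_of_finiteDimensional _
    have hc : Continuous fun z : affineSpan ℝ (C : Set V) => g j ((z : V) - x) := by fun_prop
    refine hc.continuousAt.eventually_const_lt ?_
    simpa using hε
  filter_upwards [hev] with z hz
  have hzspan : (z : V) - x ∈ Submodule.span ℝ (C : Set V) :=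
    Submodule.sub_mem _ (affineSpan_subset_span z.2) (Submodule.subset_span hxC)
  have h1 : (z : V) = x - ε • ∑ j : B, (j : V) + ∑ j : B, (ε + g j ((z : V) - x)) • (j : V) := by
    simp_rw [add_smul]
    rw [Finset.sum_add_distrib, hsum _ hzspan, ← Finset.smul_sum]
    abel
  change (z : V) ∈ C
  rw [h1]
  refine C.add_mem hxε (C.sum_mem fun j _ => PointedCone.smul_mem C ?_ (hBC j.2))
  linarith [hz j]

end RelativeInterior

/-! ### Neighborhoods of flags -/

namespace ConeFlag

variable {M : Type*} [AddCommGroup M]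

theorem prev_zero (C : ConeFlag M) (i : Fin C.len) (hi : (i : ℕ) = 0) : C.prev i = ⊥ := by
  rw [prev, if_pos hi]

theorem prev_succ (C : ConeFlag M) {i j : Fin C.len} (h : (i : ℕ) + 1 = j) :
    C.prev j = C.cone i := by
  rw [prev, if_neg (by omega)]
  congr 1
  exact Fin.ext (by simp [← h])

/-- `C_{i-1}` is a face of `C_i`; for `i = 0` this is strong convexity. -/
theorem isFaceOf_prev (C : ConeFlag M) (i : Fin C.len) : (C.prev i).IsFaceOf (C.cone i) := by
  rcases Nat.eq_zero_or_pos (i : ℕ) with hi | hi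
  · rw [C.prev_zero i hi]
    refine ⟨bot_le, fun {x y a} hx hy ha h => ?_⟩
    rw [Submodule.mem_bot] at h ⊢
    by_contra hne
    have hax : a • x ∈ C.cone i := PointedCone.smul_mem _ ha.le hx
    refine C.salient i (a • x) hax (smul_ne_zero ha.ne' hne) ?_
    rw [neg_eq_of_add_eq_zero_right h]
    exact hy
  · have hj : (i : ℕ) - 1 < C.len := by omega
    have h1 : ((⟨(i : ℕ) - 1, hj⟩ : Fin C.len) : ℕ) + 1 = i := Nat.sub_add_cancel hi
    rw [C.prev_succ h1]
    exact C.face _ _ h1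

theorem finrank_span_prev (C : ConeFlag M) (i : Fin C.len) :
    Module.finrank ℝ (Submodule.span ℝ (C.prev i : Set (RN M))) = i := by
  rcases Nat.eq_zero_or_pos (i : ℕ) with hi | hi
  · rw [C.prev_zero i hi, hi]
    have : ((⊥ : PointedCone ℝ (RN M)) : Set (RN M)) = {0} := rfl
    rw [this, Submodule.span_zero_singleton, finrank_bot]
  · have hj : (i : ℕ) - 1 < C.len := by omega
    have h1 : ((⟨(i : ℕ) - 1, hj⟩ : Fin C.len) : ℕ) + 1 = i := Nat.sub_add_cancel hi
    rw [C.prev_succ h1, C.finrank_span, h1]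

/-- The face `C_{i-1}` of `C_i` is cut out by its linear span. -/
theorem mem_prev_of_mem_span (C : ConeFlag M) (i : Fin C.len) {x : RN M} (hx : x ∈ C.cone i)
    (hspan : x ∈ Submodule.span ℝ (C.prev i : Set (RN M))) : x ∈ C.prev i := by
  obtain ⟨a, ha, b, hb, h⟩ : ∃ a ∈ C.prev i, ∃ b ∈ C.prev i, x + b = a := by
    clear hx
    induction hspan using Submodule.span_induction with
    | mem y hy => exact ⟨y, hy, 0, Submodule.zero_mem _, add_zero y⟩
    | zero => exact ⟨0, Submodule.zero_mem _, 0, Submodule.zero_mem _, add_zero 0⟩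
    | add y z _ _ hy hz =>
      obtain ⟨a, ha, b, hb, rfl⟩ := hy
      obtain ⟨a', ha', b', hb', rfl⟩ := hz
      exact ⟨_, add_mem ha ha', _, add_mem hb hb', by abel⟩
    | smul r y _ hy =>
      obtain ⟨a, ha, b, hb, rfl⟩ := hy
      rcases le_total 0 r with h0 | h0
      · exact ⟨_, PointedCone.smul_mem _ h0 ha, _, PointedCone.smul_mem _ h0 hb,
          (smul_add _ _ _).symm⟩
      · exact ⟨_, PointedCone.smul_mem _ (neg_nonneg.2 h0) hb, _,
          PointedCone.smul_mem _ (neg_nonneg.2 h0) ha, by module⟩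
  have hF := C.isFaceOf_prev i
  exact hF.mem_of_add_mem_left hx (hF.le hb) (h ▸ ha)

/-- The cone `C_i` lies on one side of the span of `C_{i-1}`: any two points of `C_i \ C_{i-1}`
differ by a positive factor modulo this span. -/
theorem exists_pos_sub_smul_mem_span [Module.Free ℤ M] [Module.Finite ℤ M] (C : ConeFlag M)
    (i : Fin C.len) {v w : RN M} (hv : v ∈ C.cone i) (hv' : v ∉ C.prev i) (hw : w ∈ C.cone i)
    (hw' : w ∉ C.prev i) :
    ∃ c : ℝ, 0 < c ∧ v - c • w ∈ Submodule.span ℝ (C.prev i : Set (RN M)) := by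
  set U := Submodule.span ℝ (C.prev i : Set (RN M)) with hU
  have hwU : w ∉ U := fun h => hw' (C.mem_prev_of_mem_span i hw h)
  have hspan : U ⊔ Submodule.span ℝ {w} = Submodule.span ℝ (C.cone i : Set (RN M)) := by
    refine Submodule.eq_of_le_of_finrank_le (sup_le ?_ ?_) ?_
    · exact Submodule.span_mono (C.isFaceOf_prev i).le
    · exact Submodule.span_mono (Set.singleton_subset_iff.2 hw)
    · rw [C.finrank_span, ← C.finrank_span_prev i]
      refine Submodule.finrank_lt_finrank_of_lt (lt_of_le_of_ne le_sup_left fun h => hwU ?_)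
      have : w ∈ U ⊔ Submodule.span ℝ {w} :=
        Submodule.mem_sup_right (Submodule.mem_span_singleton_self w)
      rwa [← h] at this
  have hvs : v ∈ U ⊔ Submodule.span ℝ {w} := by
    rw [hspan]; exact Submodule.subset_span hv
  obtain ⟨y, hy, z, hz, hyz⟩ := Submodule.mem_sup.1 hvs
  obtain ⟨c, rfl⟩ := Submodule.mem_span_singleton.1 hz
  refine ⟨c, ?_, by rw [← hyz, add_sub_cancel_right]; exact hy⟩
  by_contra! hc
  -- otherwise `v + |c| w` lies in the face, and so does `v`
  have hcw : (-c) • w ∈ C.cone i := PointedCone.smul_mem _ (neg_nonneg.2 hc) hw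
  have hmem : v + (-c) • w ∈ C.prev i := by
    refine C.mem_prev_of_mem_span i (add_mem hv hcw) ?_
    have h1 : v + (-c) • w = y := by rw [← hyz]; module
    rw [h1]
    exact hy
  exact hv' ((C.isFaceOf_prev i).mem_of_add_mem_left hv hcw hmem)

theorem cone_mono (C : ConeFlag M) {i j : Fin C.len} (h : i ≤ j) : C.cone i ≤ C.cone j := by
  obtain ⟨i, hi⟩ := i
  obtain ⟨j, hj⟩ := j
  replace h : i ≤ j := h
  induction h with
  | refl => exact le_rfl
  | step h ih => exact (ih (by omega)).trans (C.face ⟨_, _⟩ ⟨_, _⟩ rfl).le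

variable [Module.Free ℤ M] [Module.Finite ℤ M]

namespace Selection

variable {C : ConeFlag M}

/-- A functional that vanishes on `w_0, …, w_{i-1}` vanishes on `C_{i-1}`. -/
theorem eq_zero_of_mem_prev (w : C.Selection) (ℓ : RN M →ₗ[ℝ] ℝ) (i : Fin C.len)
    (h : ∀ j < i, ℓ (w.pt j) = 0) : ∀ x ∈ Submodule.span ℝ (C.prev i : Set (RN M)), ℓ x = 0 := by
  suffices hle : ∀ x ∈ C.prev i, ℓ x = 0 by
    intro x hx
    have : Submodule.span ℝ (C.prev i : Set (RN M)) ≤ LinearMap.ker ℓ := Submodule.span_le.2 hle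
    exact this hx
  obtain ⟨i, hi⟩ := i
  induction i with
  | zero =>
    intro x hx
    rw [C.prev_zero _ rfl] at hx
    rw [(Submodule.mem_bot _).1 hx, map_zero]
  | succ i ih =>
    have hi' : i < C.len := by omega
    have ih' := ih hi' fun j hj => h j (lt_trans hj (Nat.lt_succ_self i))
    have hker : Submodule.span ℝ (C.prev ⟨i, hi'⟩ : Set (RN M)) ≤ LinearMap.ker ℓ :=
      Submodule.span_le.2 ih'
    intro x hx
    rw [C.prev_succ (i := ⟨i, hi'⟩) rfl] at hx
    by_cases hx' : x ∈ C.prev ⟨i, hi'⟩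
    · exact ih' x hx'
    · obtain ⟨c, -, hc⟩ := C.exists_pos_sub_smul_mem_span ⟨i, hi'⟩ hx hx' (w.mem _) (w.notMem _)
      have h1 : ℓ (x - c • w.pt ⟨i, hi'⟩) = 0 := hker hc
      rwa [map_sub, map_smul, h ⟨i, hi'⟩ (Nat.lt_succ_self i), smul_zero, sub_zero] at h1

/-- The lexicographic sign of a functional on the points of a selection does not depend on the
selection. -/
theorem lexNonpos_congr (w w' : C.Selection) (ℓ : RN M →ₗ[ℝ] ℝ)
    (h : LexNonpos fun i => ℓ (w.pt i)) : LexNonpos fun i => ℓ (w'.pt i) := by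
  intro i hi
  have hw' := w'.eq_zero_of_mem_prev ℓ i hi
  obtain ⟨c, hc, hmem⟩ :=
    C.exists_pos_sub_smul_mem_span i (w'.mem i) (w'.notMem i) (w.mem i) (w.notMem i)
  have h1 := hw' _ hmem
  rw [map_sub, map_smul, sub_eq_zero] at h1
  change ℓ (w'.pt i) ≤ 0
  rw [h1]
  refine mul_nonpos_of_nonneg_of_nonpos hc.le (h i fun j hj => ?_)
  have hle : C.cone j ≤ C.prev i := by
    have hk : (i : ℕ) - 1 < C.len := by omega
    have hj' : (j : ℕ) < i := hj
    rw [C.prev_succ (i := ⟨(i : ℕ) - 1, hk⟩) (by simp; omega)]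
    exact C.cone_mono (Fin.le_def.2 (by simp; omega))
  exact hw' _ (Submodule.subset_span (hle (w.mem j)))

end Selection

/-- A relative interior point of `C_i` is not in the proper face `C_{i-1}`. -/
theorem notMem_prev_of_forall_sub_smul_mem (C : ConeFlag M) (i : Fin C.len) {x : RN M}
    (hx : ∀ p ∈ C.cone i, ∃ ε : ℝ, 0 < ε ∧ x - ε • p ∈ C.cone i) : x ∉ C.prev i := by
  intro hmem
  have hle : C.cone i ≤ C.prev i := by
    intro p hp
    obtain ⟨ε, hε, h⟩ := hx p hp
    refine (C.isFaceOf_prev i).mem_of_smul_add_mem hp h hε ?_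
    rwa [add_sub_cancel]
  have h1 := Submodule.finrank_mono (Submodule.span_mono (R := ℝ) hle)
  rw [C.finrank_span, C.finrank_span_prev] at h1
  omega

/-- A selection of points of a flag from which positive multiples of arbitrary points of the
respective cone can be subtracted. -/
theorem exists_selection_interior (C : ConeFlag M) :
    ∃ p : C.Selection, ∀ i, ∀ x ∈ C.cone i, ∃ ε : ℝ, 0 < ε ∧ p.pt i - ε • x ∈ C.cone i := by
  choose p hp hp' using fun i =>
    PointedCone.exists_forall_sub_smul_mem_of_fg (C.polyhedral i)
  exact ⟨⟨p, hp, fun i => C.notMem_prev_of_forall_sub_smul_mem i (hp' i)⟩, hp'⟩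

/-- A `Γ`-admissible cone is a neighborhood of a flag if and only if each of its defining
functionals is lexicographically at most `0` on the points `w_i ∈ C_i \ C_{i-1}`. If it is, the
points `p_0 + ε p_1 + ⋯ + ε^i p_i` with `p_j` in the relative interior of `C_j` lie in it for small
`ε > 0`. -/
theorem isNeighborhood_iff {Γ : Set ℝ} {C : ConeFlag M} (w : C.Selection) {q : ℕ} (γ : Fin q → ℝ)
    (u : Fin q → M) (hγ : ∀ l, γ l ∈ Γ) :
    C.IsNeighborhood Γ {x | 0 ≤ x.1 ∧ ∀ l, pairing x (γ l) (u l) ≤ 0} ↔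
      ∀ l, LexNonpos fun i => pairingLin (γ l, u l) (w.pt i) := by
  constructor
  · rintro ⟨-, h⟩ l
    choose v hv using h
    have hint : ∀ i, ∀ x ∈ C.cone i, ∃ ε : ℝ, 0 < ε ∧ v i - ε • x ∈ C.cone i :=
      fun i x hx => sub_smul_mem_of_mem_intrinsicInterior (hv i).2 hx
    let p : C.Selection := ⟨v, fun i => intrinsicInterior_subset (hv i).2,
      fun i => C.notMem_prev_of_forall_sub_smul_mem i (hint i)⟩
    exact p.lexNonpos_congr w _ fun i _ => (hv i).1.2 l
  · intro h
    refine ⟨⟨q, γ, u, hγ, rfl⟩, fun i => ?_⟩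
    obtain ⟨p, hp⟩ := C.exists_selection_interior
    have hlex : ∀ l, LexNonpos fun j : Fin (i + 1) =>
        pairingLin (γ l, u l) (p.pt (Fin.castLE (by omega) j)) := fun l j hj =>
      w.lexNonpos_congr p _ (h l) _ fun j' hj' => by
        have hj'' : (j' : ℕ) < j := hj'
        exact hj ⟨j', by omega⟩ hj'
    obtain ⟨ε, hε, hpos⟩ := ((Filter.eventually_all.2 fun l =>
      (hlex l).eventually_sum_nonpos).and self_mem_nhdsWithin).exists
    have hε0 : 0 < ε := hpos
    set x : RN M := ∑ j : Fin (i + 1), ε ^ (j : ℕ) • p.pt (Fin.castLE (by omega) j) with hx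
    have hmem : ∀ j : Fin (i + 1), ε ^ (j : ℕ) • p.pt (Fin.castLE (by omega) j) ∈ C.cone i :=
      fun j => PointedCone.smul_mem _ (by positivity)
        (C.cone_mono (Fin.le_def.2 (by simp; omega)) (p.mem _))
    have hxC : x ∈ C.cone i := (C.cone i).sum_mem fun j _ => hmem j
    refine ⟨x, ⟨C.fst_nonneg i x hxC, fun l => ?_⟩,
      mem_intrinsicInterior_of_forall_sub_smul_mem hxC fun y hy => ?_⟩
    · have := hε l
      rw [← pairingLin_apply (γ l, u l), hx, map_sum]
      simpa only [map_smul, smul_eq_mul] using this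
    · -- the last summand absorbs a small multiple of `y`
      obtain ⟨δ, hδ, hy'⟩ := hp i y hy
      refine ⟨ε ^ (i : ℕ) * δ, by positivity, ?_⟩
      rw [hx, Fin.sum_univ_castSucc, add_sub_assoc]
      refine add_mem (sum_mem fun j _ => hmem _) ?_
      have := PointedCone.smul_mem (C.cone i) (show 0 ≤ ε ^ (i : ℕ) by positivity) hy'
      rwa [smul_sub, smul_smul] at this

end ConeFlag

/-! ### Simplicial flags and the classification of flags -/

section SimplicialFlag

variable {V : Type*} [AddCommGroup V] [Module ℝ V] {k : ℕ} {w : Fin k → V}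

theorem mem_hull_image_iff {T : Set (Fin k)} {x : V} :
    x ∈ PointedCone.hull ℝ (w '' T) ↔
      ∃ c : Fin k → ℝ, (∀ j, 0 ≤ c j) ∧ (∀ j ∉ T, c j = 0) ∧ x = ∑ j, c j • w j := by
  classical
  constructor
  · intro hx
    induction hx using Submodule.span_induction with
    | mem y hy =>
      obtain ⟨j, hj, rfl⟩ := hy
      refine ⟨Pi.single j 1, fun l => ?_, fun l hl => ?_, ?_⟩
      · by_cases h : l = j
        · subst h; simp
        · simp [h]
      · exact Pi.single_eq_of_ne (fun h : l = j => hl (h ▸ hj)) _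
      · simp [Pi.single_apply]
    | zero => exact ⟨0, fun _ => le_rfl, fun _ _ => rfl, by simp⟩
    | add y z _ _ hy hz =>
      obtain ⟨c, hc, hc', rfl⟩ := hy
      obtain ⟨d, hd, hd', rfl⟩ := hz
      exact ⟨c + d, fun j => add_nonneg (hc j) (hd j),
        fun j hj => by simp [hc' j hj, hd' j hj], by simp [add_smul, Finset.sum_add_distrib]⟩
    | smul r y _ hy =>
      obtain ⟨c, hc, hc', rfl⟩ := hy
      refine ⟨(r : ℝ) • c, fun j => mul_nonneg r.2 (hc j), fun j hj => by simp [hc' j hj], ?_⟩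
      have h1 : r • ∑ j, c j • w j = (r : ℝ) • ∑ j, c j • w j := rfl
      rw [h1]
      simp [Finset.smul_sum, smul_smul]
  · rintro ⟨c, hc, hc', rfl⟩
    refine Submodule.sum_mem _ fun j _ => ?_
    by_cases hj : j ∈ T
    · exact PointedCone.smul_mem _ (hc j) (Submodule.subset_span ⟨j, hj, rfl⟩)
    · rw [hc' j hj, zero_smul]
      exact Submodule.zero_mem _

theorem LinearIndependent.coeff_eq (hw : LinearIndependent ℝ w) {c d : Fin k → ℝ}
    (h : ∑ j, c j • w j = ∑ j, d j • w j) : c = d := by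
  funext j
  have := Fintype.linearIndependent_iff.1 hw (c - d) (by
    simp only [Pi.sub_apply, sub_smul, Finset.sum_sub_distrib, h, sub_self]) j
  exact sub_eq_zero.1 this

theorem LinearIndependent.notMem_hull_image (hw : LinearIndependent ℝ w) {T : Set (Fin k)}
    {i : Fin k} (hi : i ∉ T) : w i ∉ PointedCone.hull ℝ (w '' T) := by
  classical
  intro h
  obtain ⟨c, -, hc', h⟩ := mem_hull_image_iff.1 h
  have h1 : ∑ j, (Pi.single i 1 : Fin k → ℝ) j • w j = ∑ j, c j • w j := by
    rw [← h]; simp [Pi.single_apply]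
  have h2 := congrFun (hw.coeff_eq h1) i
  rw [hc' i hi, Pi.single_eq_same] at h2
  exact one_ne_zero h2

end SimplicialFlag

namespace ConeFlag

variable {M : Type*} [AddCommGroup M]

/-- The simplicial flag of the cones generated by the initial segments of a list of linearly
independent points of `ℝ_{≥0} × N_ℝ`. -/
def ofLinearIndependent {k : ℕ} (w : Fin k → RN M) (hli : LinearIndependent ℝ w)
    (hw : ∀ i, 0 ≤ (w i).1) : ConeFlag M where
  len := k
  cone i := PointedCone.hull ℝ (w '' Set.Iic i)
  polyhedral i := Submodule.fg_span ((Set.toFinite _).image w)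
  salient i x hx hne hx' := by
    obtain ⟨c, hc, -, rfl⟩ := mem_hull_image_iff.1 hx
    obtain ⟨d, hd, -, h⟩ := mem_hull_image_iff.1 hx'
    have h1 : (-c) = d := hli.coeff_eq (by rw [← h]; simp)
    apply hne
    refine Finset.sum_eq_zero fun j _ => ?_
    have h2 : -c j = d j := congrFun h1 j
    rw [le_antisymm (by linarith [hd j]) (hc j), zero_smul]
  fst_nonneg i x hx := by
    obtain ⟨c, hc, -, rfl⟩ := mem_hull_image_iff.1 hx
    rw [Prod.fst_sum]
    exact Finset.sum_nonneg fun j _ => mul_nonneg (hc j) (hw j)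
  finrank_span i := by
    have h1 : Submodule.span ℝ (PointedCone.hull ℝ (w '' Set.Iic i) : Set (RN M)) =
        Submodule.span ℝ (Set.range fun j : Set.Iic i => w j) := by
      rw [← Set.image_eq_range]
      exact le_antisymm (Submodule.span_le.2 (PointedCone.hull_le_span ℝ _))
        (Submodule.span_mono PointedCone.subset_hull)
    rw [h1]
    refine (finrank_span_eq_card (hli.comp _ Subtype.val_injective)).trans ?_
    rw [← Set.toFinset_card, Set.toFinset_Iic, Fin.card_Iic]
  face i j hij := by
    have hle : i ≤ j := Fin.le_def.2 (by omega)
    refine ⟨Submodule.span_mono (Set.image_mono (Set.Iic_subset_Iic.2 hle)),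
      fun {x y a} hx hy ha h => ?_⟩
    obtain ⟨c, hc, -, rfl⟩ := mem_hull_image_iff.1 hx
    obtain ⟨d, hd, -, rfl⟩ := mem_hull_image_iff.1 hy
    obtain ⟨e, -, he', h⟩ := mem_hull_image_iff.1 h
    have h1 : a • c + d = e := hli.coeff_eq (by
      rw [← h]; simp [add_smul, Finset.sum_add_distrib, Finset.smul_sum, smul_smul])
    refine mem_hull_image_iff.2 ⟨c, hc, fun l hl => ?_, rfl⟩
    have h2 : a * c l + d l = 0 := (congrFun h1 l).trans (he' l hl)
    have h3 : a * c l ≤ 0 := by linarith [hd l]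
    exact le_antisymm (nonpos_of_mul_nonpos_right h3 ha) (hc l)

theorem isSimplicial_ofLinearIndependent {k : ℕ} (w : Fin k → RN M)
    (hli : LinearIndependent ℝ w) (hw : ∀ i, 0 ≤ (w i).1) :
    (ofLinearIndependent w hli hw).IsSimplicial := fun i =>
  PointedCone.IsSimplicial.hull ((Set.toFinite (Set.Iic i)).image w)
    (hli.linearIndepOn_id.mono (Set.image_subset_range _ _))

/-- The generators as points of the flag that they generate. -/
def selectionOfLinearIndependent {k : ℕ} (w : Fin k → RN M) (hli : LinearIndependent ℝ w)
    (hw : ∀ i, 0 ≤ (w i).1) : (ofLinearIndependent w hli hw).Selection where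
  pt := w
  mem i := PointedCone.subset_hull ⟨i, Set.mem_Iic.2 le_rfl, rfl⟩
  notMem i := by
    rcases Nat.eq_zero_or_pos (i : ℕ) with hi | hi
    · rw [prev_zero _ _ hi]
      exact fun h => hli.ne_zero i ((Submodule.mem_bot _).1 h)
    · have hj : (i : ℕ) - 1 < k := lt_of_le_of_lt (Nat.sub_le _ _) i.2
      rw [prev_succ (C := ofLinearIndependent w hli hw) (i := ⟨(i : ℕ) - 1, hj⟩)
        (Nat.sub_add_cancel hi)]
      refine hli.notMem_hull_image fun h => ?_
      have h' : (i : ℕ) ≤ (i : ℕ) - 1 := h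
      omega

/-- The order cone of a flag: the elements of `Γ × M` whose half-space is a neighborhood. -/
def orderCone (Γ : Set ℝ) (C : ConeFlag M) : Set (ℝ × M) :=
  {a | a.1 ∈ Γ ∧ C.IsNeighborhood Γ {x | 0 ≤ x.1 ∧ pairing x a.1 a.2 ≤ 0}}

variable [Module.Free ℤ M] [Module.Finite ℤ M]

theorem isNeighborhood_iff_forall_mem_orderCone {Γ : Set ℝ} (C : ConeFlag M) {q : ℕ}
    (γ : Fin q → ℝ) (u : Fin q → M) (hγ : ∀ l, γ l ∈ Γ) :
    C.IsNeighborhood Γ {x | 0 ≤ x.1 ∧ ∀ l, pairing x (γ l) (u l) ≤ 0} ↔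
      ∀ l, (γ l, u l) ∈ C.orderCone Γ := by
  obtain ⟨p, -⟩ := C.exists_selection_interior
  rw [isNeighborhood_iff p γ u hγ]
  refine forall_congr' fun l => ?_
  have h := isNeighborhood_iff (Γ := Γ) p (fun _ : Fin 1 => γ l) (fun _ => u l) (fun _ => hγ l)
  simp only [forall_const] at h
  rw [← h]
  exact ⟨fun h => ⟨hγ l, h⟩, fun h => h.2⟩

theorem orderCone_eq_lexCone (Γ : AddSubgroup ℝ) {C : ConeFlag M} (w : C.Selection) :
    C.orderCone (Γ : Set ℝ) = lexCone Γ w.pt := by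
  ext a
  refine and_congr_right fun ha => ?_
  have h := isNeighborhood_iff (Γ := (Γ : Set ℝ)) w (fun _ : Fin 1 => a.1) (fun _ => a.2)
    (fun _ => ha)
  simpa only [forall_const] using h

/-- An admissible cone is a neighborhood if and only if its half-spaces are, so half-spaces detect
local equivalence. -/
theorem locEquiv_iff_orderCone_eq {Γ : Set ℝ} {C C' : ConeFlag M} :
    C.LocEquiv Γ C' ↔ C.orderCone Γ = C'.orderCone Γ := by
  constructor
  · intro h
    ext a
    exact and_congr_right fun _ => h _
  · intro h D
    constructor
    · rintro hD
      obtain ⟨q, γ, u, hγ, rfl⟩ := hD.1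
      rw [isNeighborhood_iff_forall_mem_orderCone _ γ u hγ] at hD ⊢
      rwa [← h]
    · rintro hD
      obtain ⟨q, γ, u, hγ, rfl⟩ := hD.1
      rw [isNeighborhood_iff_forall_mem_orderCone _ γ u hγ] at hD ⊢
      rwa [h]

theorem isOrderCone_orderCone (Γ : AddSubgroup ℝ) (C : ConeFlag M) :
    IsOrderCone Γ (C.orderCone (Γ : Set ℝ)) := by
  obtain ⟨p, -⟩ := C.exists_selection_interior
  rw [orderCone_eq_lexCone Γ p]
  exact isOrderCone_lexCone _ fun i => C.fst_nonneg i _ (p.mem i)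

/-- Flags modulo local equivalence correspond to order cones. -/
noncomputable def quotientEquiv (Γ : AddSubgroup ℝ) (M : Type*) [AddCommGroup M]
    [Module.Free ℤ M] [Module.Finite ℤ M] :
    Quotient (locSetoid (Γ : Set ℝ) M) ≃ OrderCone Γ M :=
  Equiv.ofBijective
    (Quotient.lift (fun C => ⟨C.orderCone (Γ : Set ℝ), C.isOrderCone_orderCone Γ⟩)
      fun _ _ h => Subtype.ext (locEquiv_iff_orderCone_eq.1 h))
    ⟨by
      rintro ⟨C⟩ ⟨C'⟩ h
      exact Quotient.sound (locEquiv_iff_orderCone_eq.2 (congrArg Subtype.val h)),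
    by
      rintro ⟨Q, hQ⟩
      obtain ⟨k, w, hli, hw, rfl⟩ := hQ.exists_eq_lexCone
      exact ⟨Quotient.mk _ (ofLinearIndependent w hli hw),
        Subtype.ext (orderCone_eq_lexCone Γ (selectionOfLinearIndependent w hli hw))⟩⟩

/-- The simplicial flag is spanned by points that represent the order cone of the given flag. -/
theorem exists_isSimplicial_locEquiv (Γ : AddSubgroup ℝ) (C : ConeFlag M) :
    ∃ C' : ConeFlag M, C'.IsSimplicial ∧ C.LocEquiv (Γ : Set ℝ) C' ∧ Nonempty C'.Selection := by
  obtain ⟨k, w, hli, hw, h⟩ := (C.isOrderCone_orderCone Γ).exists_eq_lexCone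
  refine ⟨ofLinearIndependent w hli hw, isSimplicial_ofLinearIndependent w hli hw, ?_,
    ⟨selectionOfLinearIndependent w hli hw⟩⟩
  rw [locEquiv_iff_orderCone_eq, h]
  exact (orderCone_eq_lexCone Γ (selectionOfLinearIndependent w hli hw)).symm

end ConeFlag

/-! ### Prime filters of fan support sets -/

section Filters

variable {M : Type*} [AddCommGroup M]

/-- The cone in `ℝ_{≥0} × N_ℝ` on which the functionals in `s` are nonpositive. -/
def coneOf (s : Set (ℝ × M)) : Set (RN M) :=
  {x | 0 ≤ x.1 ∧ ∀ a ∈ s, pairingLin a x ≤ 0}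

theorem isAdmissibleCone_iff {Γ : Set ℝ} {D : Set (RN M)} :
    IsAdmissibleCone Γ D ↔ ∃ s : Finset (ℝ × M), (∀ a ∈ s, a.1 ∈ Γ) ∧ D = coneOf s := by
  classical
  constructor
  · rintro ⟨q, γ, u, hγ, rfl⟩
    refine ⟨Finset.univ.image fun l => (γ l, u l), ?_, ?_⟩
    · simpa using hγ
    · ext x
      simp [coneOf, pairingLin_apply]
  · rintro ⟨s, hs, rfl⟩
    refine ⟨s.card, fun i => (s.equivFin.symm i : ℝ × M).1, fun i => (s.equivFin.symm i : ℝ × M).2,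
      fun i => hs _ (s.equivFin.symm i).2, ?_⟩
    ext x
    refine and_congr_right fun _ => ⟨fun h i => h _ (s.equivFin.symm i).2, fun h a ha => ?_⟩
    simpa [pairingLin_apply] using h (s.equivFin ⟨a, ha⟩)

variable {Γ : AddSubgroup ℝ}

/-- The half-space of `a ∈ Γ × M` as a fan support set. -/
def halfSpace (a : ℝ × M) (ha : a.1 ∈ Γ) : FanSet (Γ : Set ℝ) M :=
  ⟨coneOf {a}, 1, fun _ => coneOf {a}, fun _ => isAdmissibleCone_iff.2 ⟨{a}, by simpa using ha,
    by simp⟩, (Set.iUnion_const _).symm⟩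

/-- A set contains an admissible cone all of whose defining functionals belong to `Q`. -/
def ContainsCone (Q : Set (ℝ × M)) (U : Set (RN M)) : Prop :=
  ∃ s : Finset (ℝ × M), (∀ a ∈ s, a ∈ Q) ∧ coneOf (s : Set (ℝ × M)) ⊆ U

/-- Finitely many elements `≤ 0` and `> 0` of the preordered group `Γ × M` are strictly separated by
a point of `ℝ_{≥0} × N_ℝ`, namely by a small perturbation `w_1 + ε w_2 + ε² w_3 + ⋯` of the first
point of a list `w_1, w_2, …` that defines the preorder. -/
theorem IsOrderCone.exists_separating [Module.Free ℤ M] [Module.Finite ℤ M] {Q : Set (ℝ × M)}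
    (hQ : IsOrderCone Γ Q) (s t : Finset (ℝ × M)) (hs : ∀ a ∈ s, a ∈ Q)
    (ht : ∀ a ∈ t, a.1 ∈ Γ ∧ a ∉ Q) :
    ∃ x ∈ coneOf (s : Set (ℝ × M)), ∀ a ∈ t, 0 < pairingLin a x := by
  obtain ⟨k, w, -, hw, rfl⟩ := hQ.exists_eq_lexCone
  have h1 := (Finset.eventually_all s).2 fun a ha => (hs a ha).2.eventually_sum_nonpos
  have h2 := (Finset.eventually_all t).2 fun a ha =>
    eventually_sum_pos_of_not_lexNonpos fun h => (ht a ha).2 ⟨(ht a ha).1, h⟩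
  obtain ⟨ε, ⟨h1, h2⟩, hpos⟩ := ((h1.and h2).and self_mem_nhdsWithin).exists
  have hε : 0 < ε := hpos
  have hval : ∀ a : ℝ × M, pairingLin a (∑ j : Fin k, ε ^ (j : ℕ) • w j) =
      ∑ j : Fin k, ε ^ (j : ℕ) * pairingLin a (w j) := fun a => by
    rw [map_sum]; simp only [map_smul, smul_eq_mul]
  refine ⟨∑ j : Fin k, ε ^ (j : ℕ) • w j, ⟨?_, fun a ha => ?_⟩, fun a ha => ?_⟩
  · rw [Prod.fst_sum]
    exact Finset.sum_nonneg fun j _ => mul_nonneg (by positivity) (hw j)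
  · rw [hval]; exact h1 a ha
  · rw [hval]; exact h2 a ha

/-- A fan support set that contains no cone of `Q` is covered by finitely many half-spaces of
elements outside `Q`, one for each of its cones. -/
theorem IsFanSupport.exists_cover_of_not_containsCone {Q : Set (ℝ × M)} {U : Set (RN M)}
    (hU : IsFanSupport (Γ : Set ℝ) U) (h : ¬ ContainsCone Q U) :
    ∃ t : Finset (ℝ × M), (∀ a ∈ t, a.1 ∈ Γ ∧ a ∉ Q) ∧ ∀ x ∈ U, ∃ a ∈ t, pairingLin a x ≤ 0 := by
  classical
  obtain ⟨m, D, hD, rfl⟩ := hU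
  choose s hs hDs using fun i => isAdmissibleCone_iff.1 (hD i)
  have hex : ∀ i, ∃ a ∈ s i, a ∉ Q := by
    by_contra! hcon
    obtain ⟨i, hi⟩ := hcon
    exact h ⟨s i, hi, by rw [← hDs i]; exact Set.subset_iUnion D i⟩
  choose a ha haQ using hex
  refine ⟨Finset.univ.image a, ?_, ?_⟩
  · intro b hb
    obtain ⟨i, -, rfl⟩ := Finset.mem_image.1 hb
    exact ⟨hs i _ (ha i), haQ i⟩
  · intro x hx
    obtain ⟨i, hi⟩ := Set.mem_iUnion.1 hx
    rw [hDs i] at hi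
    exact ⟨a i, Finset.mem_image_of_mem a (Finset.mem_univ i), hi.2 _ (ha i)⟩

theorem IsFanSupport.fst_nonneg {U : Set (RN M)} (hU : IsFanSupport (Γ : Set ℝ) U) {x : RN M}
    (hx : x ∈ U) : 0 ≤ x.1 := by
  obtain ⟨m, D, hD, rfl⟩ := hU
  obtain ⟨i, hi⟩ := Set.mem_iUnion.1 hx
  obtain ⟨q, γ, u, -, h⟩ := hD i
  rw [h] at hi
  exact hi.1

theorem ContainsCone.mono {Q : Set (ℝ × M)} {U V : Set (RN M)} (h : U ⊆ V)
    (hU : ContainsCone Q U) : ContainsCone Q V :=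
  let ⟨s, hs, hsU⟩ := hU
  ⟨s, hs, hsU.trans h⟩

theorem ContainsCone.inter {Q : Set (ℝ × M)} {U V : Set (RN M)} (hU : ContainsCone Q U)
    (hV : ContainsCone Q V) : ContainsCone Q (U ∩ V) := by
  classical
  obtain ⟨s, hs, hsU⟩ := hU
  obtain ⟨t, ht, htV⟩ := hV
  refine ⟨s ∪ t, fun a ha => (Finset.mem_union.1 ha).elim (hs a) (ht a),
    fun x hx => ⟨hsU ?_, htV ?_⟩⟩
  · exact ⟨hx.1, fun a ha => hx.2 a (Finset.mem_union_left t ha)⟩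
  · exact ⟨hx.1, fun a ha => hx.2 a (Finset.mem_union_right s ha)⟩

section OfCone

variable [Module.Free ℤ M] [Module.Finite ℤ M] {Q : Set (ℝ × M)} (hQ : IsOrderCone Γ Q)
include hQ

theorem IsOrderCone.not_containsCone_empty : ¬ ContainsCone Q (∅ : Set (RN M)) := by
  rintro ⟨s, hs, h⟩
  obtain ⟨x, hx, -⟩ := hQ.exists_separating s ∅ hs (by simp)
  exact h hx

theorem IsOrderCone.containsCone_union {U V : Set (RN M)} (hU : IsFanSupport (Γ : Set ℝ) U)
    (hV : IsFanSupport (Γ : Set ℝ) V) (h : ContainsCone Q (U ∪ V)) :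
    ContainsCone Q U ∨ ContainsCone Q V := by
  classical
  by_contra! hcon
  obtain ⟨t, ht, htU⟩ := hU.exists_cover_of_not_containsCone hcon.1
  obtain ⟨t', ht', htV⟩ := hV.exists_cover_of_not_containsCone hcon.2
  obtain ⟨s, hs, hsUV⟩ := h
  obtain ⟨x, hx, hxt⟩ := hQ.exists_separating s (t ∪ t') hs
    fun a ha => (Finset.mem_union.1 ha).elim (ht a) (ht' a)
  rcases hsUV hx with hxU | hxV
  · obtain ⟨a, ha, hle⟩ := htU x hxU
    exact absurd (hxt a (Finset.mem_union_left t' ha)) (not_lt.2 hle)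
  · obtain ⟨a, ha, hle⟩ := htV x hxV
    exact absurd (hxt a (Finset.mem_union_right t ha)) (not_lt.2 hle)

theorem IsOrderCone.containsCone_halfSpace_iff (a : ℝ × M) (ha : a.1 ∈ Γ) :
    ContainsCone Q (halfSpace a ha).1 ↔ a ∈ Q := by
  constructor
  · rintro ⟨s, hs, h⟩
    by_contra hcon
    obtain ⟨x, hx, hxa⟩ := hQ.exists_separating s {a} hs (by simpa using ⟨ha, hcon⟩)
    exact absurd (hxa a (Finset.mem_singleton_self a)) (not_lt.2 ((h hx).2 a rfl))
  · intro h
    exact ⟨{a}, by simpa using h, by simp [halfSpace]⟩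

theorem IsOrderCone.isPFilter : Order.IsPFilter {U : FanSet (Γ : Set ℝ) M | ContainsCone Q U.1} :=
  Order.IsPFilter.of_def
    ⟨halfSpace 0 Γ.zero_mem, (hQ.containsCone_halfSpace_iff _ _).2 hQ.zero_mem⟩
    (fun U hU V hV => ⟨U ⊓ V, hU.inter hV, inf_le_left, inf_le_right⟩)
    (fun h hU => hU.mono h)

theorem IsOrderCone.isPrime_toPFilter : hQ.isPFilter.toPFilter.IsPrime where
  compl_ideal :=
    { IsLowerSet := fun _ _ h hU hV => hU (hV.mono h)
      Nonempty := ⟨⟨∅, 0, Fin.elim0, fun i => i.elim0, by simp⟩, hQ.not_containsCone_empty⟩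
      Directed := fun U hU V hV => ⟨U ⊔ V, fun h =>
        (hQ.containsCone_union U.2 V.2 h).elim hU hV, le_sup_left, le_sup_right⟩ }

end OfCone

/-- The elements of `Γ × M` whose half-space belongs to the filter. -/
def filterCone (F : FanPrimeFilter (Γ : Set ℝ) M) : Set (ℝ × M) :=
  {a | ∃ ha : a.1 ∈ Γ, halfSpace a ha ∈ F.1}

theorem mem_of_subset {F : FanPrimeFilter (Γ : Set ℝ) M} {U V : FanSet (Γ : Set ℝ) M}
    (h : U.1 ⊆ V.1) (hU : U ∈ F.1) : V ∈ F.1 :=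
  Order.PFilter.mem_of_le (show U ≤ V from h) hU

theorem isOrderCone_filterCone (F : FanPrimeFilter (Γ : Set ℝ) M) :
    IsOrderCone Γ (filterCone F) where
  fst_mem a ha := ha.1
  add_mem a ha b hb := by
    obtain ⟨ha, haF⟩ := ha
    obtain ⟨hb, hbF⟩ := hb
    refine ⟨Γ.add_mem ha hb, mem_of_subset ?_ (Order.PFilter.inf_mem haF hbF)⟩
    rintro x ⟨⟨h0, hxa⟩, -, hxb⟩
    refine ⟨h0, fun c hc => ?_⟩
    rw [Set.mem_singleton_iff.1 hc, pairingLin_add]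
    exact add_nonpos (hxa a rfl) (hxb b rfl)
  total a ha := by
    by_contra! hcon
    have h1 : halfSpace a ha ∉ F.1 := fun h => hcon.1 ⟨ha, h⟩
    have h2 : halfSpace (-a) (Γ.neg_mem ha) ∉ F.1 := fun h => hcon.2 ⟨_, h⟩
    obtain ⟨z, hz, hz1, hz2⟩ := F.2.compl_ideal.Directed _ h1 _ h2
    apply hz
    -- `z` contains the two opposite half-spaces and hence everything
    obtain ⟨y, hy⟩ := F.1.nonempty
    refine mem_of_subset (fun x hx => ?_) hy
    have h0 := y.2.fst_nonneg hx
    rcases le_total (pairingLin a x) 0 with h | h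
    · exact hz1 ⟨h0, fun c hc => by rwa [Set.mem_singleton_iff.1 hc]⟩
    · exact hz2 ⟨h0, fun c hc => by
        rw [Set.mem_singleton_iff.1 hc, pairingLin_neg]
        exact neg_nonpos.2 h⟩
  nonpos_mem γ hγ hγ0 := by
    obtain ⟨y, hy⟩ := F.1.nonempty
    refine ⟨hγ, mem_of_subset (fun x hx => ?_) hy⟩
    have h0 := y.2.fst_nonneg hx
    refine ⟨h0, fun c hc => ?_⟩
    rw [Set.mem_singleton_iff.1 hc]
    simpa [pairingLin_apply, pairing] using mul_nonpos_of_nonneg_of_nonpos h0 hγ0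

/-- A prime filter consists of the sets that contain a finite intersection of half-spaces of the
filter. -/
theorem mem_iff_containsCone_filterCone (F : FanPrimeFilter (Γ : Set ℝ) M)
    (U : FanSet (Γ : Set ℝ) M) : U ∈ F.1 ↔ ContainsCone (filterCone F) U.1 := by
  classical
  constructor
  · intro hU
    obtain ⟨m, D, hD, hUD⟩ := U.2
    let E : Fin m → FanSet (Γ : Set ℝ) M := fun i =>
      ⟨D i, 1, fun _ => D i, fun _ => hD i, (Set.iUnion_const _).symm⟩
    obtain ⟨i, hi⟩ : ∃ i, E i ∈ F.1 := by
      by_contra! hcon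
      have key : ∀ t : Finset (Fin m), ∃ z, z ∉ F.1 ∧ ∀ i ∈ t, E i ≤ z := fun t => by
        induction t using Finset.induction_on with
        | empty =>
          obtain ⟨z, hz⟩ := F.2.compl_ideal.Nonempty
          exact ⟨z, hz, by simp⟩
        | insert i t _ ih =>
          obtain ⟨z, hz, hzt⟩ := ih
          obtain ⟨z', hz', h1, h2⟩ := F.2.compl_ideal.Directed _ (hcon i) _ hz
          refine ⟨z', hz', fun j hj => ?_⟩
          rcases Finset.mem_insert.1 hj with rfl | hj
          · exact h1
          · exact (hzt j hj).trans h2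
      obtain ⟨z, hz, hzE⟩ := key Finset.univ
      refine hz (mem_of_subset ?_ hU)
      rw [hUD]
      exact Set.iUnion_subset fun i => hzE i (Finset.mem_univ i)
    obtain ⟨s, hs, hDs⟩ := isAdmissibleCone_iff.1 (hD i)
    refine ⟨s, fun a ha => ⟨hs a ha, mem_of_subset ?_ hi⟩, ?_⟩
    · change D i ⊆ _
      rw [hDs]
      exact fun x hx => ⟨hx.1, fun b hb => by
        rw [Set.mem_singleton_iff.1 hb]; exact hx.2 a ha⟩
    · rw [← hDs, hUD]
      exact Set.subset_iUnion D i
  · rintro ⟨s, hs, hsU⟩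
    have key : ∀ t : Finset (ℝ × M), (∀ a ∈ t, a ∈ filterCone F) →
        ∃ z ∈ F.1, z.1 ⊆ coneOf (t : Set (ℝ × M)) := fun t => by
      induction t using Finset.induction_on with
      | empty =>
        intro _
        obtain ⟨z, hz⟩ := F.1.nonempty
        exact ⟨z, hz, fun x hx => ⟨z.2.fst_nonneg hx, by simp⟩⟩
      | insert a t _ ih =>
        intro h
        obtain ⟨z, hz, hzt⟩ := ih fun b hb => h b (Finset.mem_insert_of_mem hb)
        obtain ⟨ha, haF⟩ := h a (Finset.mem_insert_self a t)
        refine ⟨_, Order.PFilter.inf_mem haF hz, fun x hx => ⟨hx.1.1, fun b hb => ?_⟩⟩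
        rcases Finset.mem_insert.1 hb with rfl | hb
        · exact hx.1.2 b rfl
        · exact (hzt hx.2).2 b hb
    obtain ⟨z, hz, hzs⟩ := key s hs
    exact mem_of_subset (hzs.trans hsU) hz

/-- Order cones correspond to prime filters. -/
noncomputable def filterEquiv (Γ : AddSubgroup ℝ) (M : Type*) [AddCommGroup M]
    [Module.Free ℤ M] [Module.Finite ℤ M] : OrderCone Γ M ≃ FanPrimeFilter (Γ : Set ℝ) M :=
  Equiv.ofBijective (fun Q => ⟨Q.2.isPFilter.toPFilter, Q.2.isPrime_toPFilter⟩)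
    ⟨fun Q Q' h => Subtype.ext <| by
      have h1 : ∀ U : FanSet (Γ : Set ℝ) M, ContainsCone Q.1 U.1 ↔ ContainsCone Q'.1 U.1 :=
        fun U => Set.ext_iff.1 (congrArg (fun F => (F.1 : Set (FanSet (Γ : Set ℝ) M))) h) U
      ext a
      constructor
      · intro ha
        have hΓ := Q.2.fst_mem a ha
        rwa [← Q'.2.containsCone_halfSpace_iff a hΓ, ← h1, Q.2.containsCone_halfSpace_iff]
      · intro ha
        have hΓ := Q'.2.fst_mem a ha
        rwa [← Q.2.containsCone_halfSpace_iff a hΓ, h1, Q'.2.containsCone_halfSpace_iff],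
    fun F => ⟨⟨filterCone F, isOrderCone_filterCone F⟩, Subtype.ext <| SetLike.coe_injective <|
      Set.ext fun U => (mem_iff_containsCone_filterCone F U).symm⟩⟩

theorem term_coeff_ne_zero {S : Subsemiring TropReal} {γ : ℝ} (hγ : γ ∈ valueGroup S) :
    (⟨MaxPlus.tPow γ, hγ⟩ : S) ≠ 0 := fun h =>
  MaxPlus.tPow_ne_zero γ (congrArg Subtype.val h)

theorem homEval_term {S : Subsemiring TropReal} (a : ℝ × M) (ha : a.1 ∈ valueGroup S) (x : RN M) :
    homEval (term a ha) x = ((pairingLin a x : ℝ) : WithBot ℝ) := by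
  classical
  unfold homEval term
  rw [AddMonoidAlgebra.coeff_single, Finsupp.support_single _ (term_coeff_ne_zero ha),
    Finset.sup_singleton, Finsupp.single_eq_same, TropReal.log_tPow]
  rfl

/-- The filter of a prime congruence in terms of its order cone. If `f_i ≤_P f_0`, then every term
of `f_i` is at most some term of `f_0` modulo `P`, and the differences of these terms define a cone
contained in `R̃(f_0, …, f_m)`. -/
theorem IsPrimeCongruence.mem_filterOf_iff {S : Subsemiring TropReal} (hS : IsSubsemifield S)
    {P : RingCon (AddMonoidAlgebra S M)} (hP : IsPrimeCongruence P) (U : FanSet (valueGroup S) M) :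
    U ∈ filterOf P ↔ ContainsCone (termCone P) U.1 := by
  classical
  constructor
  · rintro ⟨m, f₀, f, hU, hf⟩
    have hex : ∀ p : Σ i, (f i).coeff.support, ∃ v ∈ f₀.coeff.support,
        (TropReal.log ((f p.1).coeff p.2), (p.2 : M)) - (TropReal.log (f₀.coeff v), v)
          ∈ termCone P := fun p => (hP.leAt_iff hS _ _).1 (hf p.1) p.2 p.2.2
    choose v hv hvP using hex
    refine ⟨Finset.univ.image fun p : Σ i, (f i).coeff.support =>
      (TropReal.log ((f p.1).coeff p.2), (p.2 : M)) - (TropReal.log (f₀.coeff (v p)), v p), ?_, ?_⟩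
    · intro a ha
      obtain ⟨p, -, rfl⟩ := Finset.mem_image.1 ha
      exact hvP p
    · refine Set.Subset.trans (fun x hx => ?_) hU
      refine ⟨hx.1, fun i => Finset.sup_le fun u hu => ?_⟩
      have h1 := hx.2 _ (Finset.mem_coe.2 (Finset.mem_image_of_mem _ (Finset.mem_univ
        (⟨i, u, hu⟩ : Σ i, (f i).coeff.support))))
      rw [sub_eq_add_neg, pairingLin_add, pairingLin_neg, ← sub_eq_add_neg, sub_nonpos] at h1
      exact (WithBot.coe_le_coe.2 h1).trans
        (Finset.le_sup (f := fun u => ((pairing x (TropReal.log (f₀.coeff u)) u : ℝ) : WithBot ℝ))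
          (hv ⟨i, u, hu⟩))
  · rintro ⟨s, hs, hsU⟩
    refine ⟨s.card, 1, fun i => term (s.equivFin.symm i : ℝ × M) (hs _ (s.equivFin.symm i).2).1,
      fun x hx => hsU ⟨hx.1, fun a ha => ?_⟩, fun i => (hs _ (s.equivFin.symm i).2).2⟩
    have h1 := hx.2 (s.equivFin ⟨a, ha⟩)
    have h0 := homEval_term (0 : ℝ × M) S.one_mem x
    rw [pairingLin_zero] at h0
    rw [homEval_term, show homEval (1 : AddMonoidAlgebra S M) x = _ from h0,
      WithBot.coe_le_coe] at h1
    simpa using h1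

end Filters

/-! ### Valuated monomial preorders -/

section Preorders

variable {M : Type*} [AddCommGroup M] {K : Type*} [Monoid K] {val : Kˣ → TropReal}

/-- The exponent `(log (val c), u) ∈ Γ × M` of a monomial `c χ^u`. -/
noncomputable def monomialExponent (val : Kˣ → TropReal) (x : Kˣ × M) : ℝ × M :=
  (TropReal.log (val x.1), x.2)

/-- `val` is a homomorphism from `Kˣ` onto the group of the finite elements `t^γ`, `γ ∈ Γ`. -/
structure IsValuationOnto (Γ : AddSubgroup ℝ) (val : Kˣ → TropReal) : Prop where
  map_mul : ∀ a b, val (a * b) = val a * val b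
  exists_eq : ∀ a, ∃ γ ∈ Γ, val a = MaxPlus.tPow γ
  surj : ∀ γ ∈ Γ, ∃ a, val a = MaxPlus.tPow γ

namespace IsValuationOnto

variable {Γ : AddSubgroup ℝ} (hv : IsValuationOnto Γ val)
include hv

theorem tPow_log (a : Kˣ) : MaxPlus.tPow (TropReal.log (val a)) = val a := by
  obtain ⟨γ, -, h⟩ := hv.exists_eq a
  rw [h, TropReal.log_tPow]

theorem log_mem (a : Kˣ) : TropReal.log (val a) ∈ Γ := by
  obtain ⟨γ, hγ, h⟩ := hv.exists_eq a
  rwa [h, TropReal.log_tPow]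

theorem log_mul (a b : Kˣ) :
    TropReal.log (val (a * b)) = TropReal.log (val a) + TropReal.log (val b) := by
  rw [hv.map_mul]
  obtain ⟨γ, -, h⟩ := hv.exists_eq a
  obtain ⟨δ, -, h'⟩ := hv.exists_eq b
  rw [h, h', ← MaxPlus.tPow_add]
  rfl

theorem log_one : TropReal.log (val 1) = 0 := by
  have := hv.log_mul 1 1
  rw [one_mul] at this
  linarith

theorem add_eq_iff (a b : Kˣ) :
    val a + val b = val b ↔ TropReal.log (val a) ≤ TropReal.log (val b) := by
  obtain ⟨γ, -, h⟩ := hv.exists_eq a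
  obtain ⟨δ, -, h'⟩ := hv.exists_eq b
  rw [h, h', MaxPlus.tPow_add_tPow_eq_right_iff]
  exact Iff.rfl

theorem exponent_mul (x y : Kˣ × M) :
    monomialExponent val (x.1 * y.1, x.2 + y.2) =
      monomialExponent val x + monomialExponent val y :=
  Prod.ext (hv.log_mul _ _) rfl

theorem exponent_one : monomialExponent val ((1, 0) : Kˣ × M) = 0 := Prod.ext hv.log_one rfl

theorem exists_exponent_eq {M : Type*} (a : ℝ × M) (ha : a.1 ∈ Γ) :
    ∃ x : Kˣ × M, monomialExponent val x = a := by
  obtain ⟨c, hc⟩ := hv.surj a.1 ha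
  exact ⟨(c, a.2), Prod.ext (by rw [monomialExponent, hc, TropReal.log_tPow]) rfl⟩

/-- The preorder on monomials that is defined by an order cone. -/
theorem isValuatedMonomialPreorder {Q : Set (ℝ × M)} (hQ : IsOrderCone Γ Q) :
    IsValuatedMonomialPreorder val
      fun x y : Kˣ × M => monomialExponent val x - monomialExponent val y ∈ Q where
  refl x := by rw [sub_self]; exact hQ.zero_mem
  trans x y z hxy hyz := by
    have := hQ.add_mem _ hxy _ hyz
    rwa [sub_add_sub_cancel] at this
  total x y := by
    rw [← neg_sub (monomialExponent val x)]
    exact hQ.total _ (Γ.sub_mem (hv.log_mem _) (hv.log_mem _))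
  mul x y z h := by
    rw [hv.exponent_mul, hv.exponent_mul, add_sub_add_right_eq_sub]
    exact h
  val_le a b h := by
    have h1 : monomialExponent val ((a, 0) : Kˣ × M) - monomialExponent val ((b, 0) : Kˣ × M) =
        (TropReal.log (val a) - TropReal.log (val b), 0) := Prod.ext rfl (sub_zero 0)
    rw [h1]
    exact hQ.nonpos_mem _ (Γ.sub_mem (hv.log_mem _) (hv.log_mem _))
      (sub_nonpos.2 ((hv.add_eq_iff a b).1 h))

variable {le : Kˣ × M → Kˣ × M → Prop} (hle : IsValuatedMonomialPreorder val le)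
include hle

theorem le_of_exponent_eq {x y : Kˣ × M} (h : monomialExponent val x = monomialExponent val y) :
    le x y := by
  have h1 := hle.mul _ _ (1, x.2) (hle.val_le x.1 y.1
    ((hv.add_eq_iff _ _).2 (congrArg Prod.fst h).le))
  have h2 : x.2 = y.2 := congrArg (fun a : ℝ × M => a.2) h
  simp only [mul_one, zero_add] at h1
  rwa [show ((y.1, x.2) : Kˣ × M) = y from Prod.ext rfl h2] at h1

/-- A valuated monomial preorder depends only on the exponents of the monomials, and it is
determined by the exponents of the monomials that are at most `1`. -/
theorem le_iff_exists (x y : Kˣ × M) : le x y ↔ ∃ z, le z (1, 0) ∧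
    monomialExponent val z = monomialExponent val x - monomialExponent val y := by
  constructor
  · intro h
    have h1 := hle.mul _ _ (y.1⁻¹, -y.2) h
    simp only [mul_inv_cancel, add_neg_cancel] at h1
    refine ⟨_, h1, ?_⟩
    have h2 := hv.exponent_mul (x.1 * y.1⁻¹, x.2 + -y.2) y
    simp only [inv_mul_cancel_right, neg_add_cancel_right] at h2
    rw [eq_sub_iff_add_eq, ← h2]
  · rintro ⟨z, hz, h⟩
    have h1 := hle.mul _ _ y hz
    simp only [one_mul, zero_add] at h1
    refine hle.trans _ _ _ (hv.le_of_exponent_eq hle ?_) h1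
    rw [hv.exponent_mul, h, sub_add_cancel]

theorem isOrderCone : IsOrderCone Γ {a | ∃ z, le z (1, 0) ∧ monomialExponent val z = a} where
  fst_mem := by
    rintro _ ⟨z, -, rfl⟩
    exact hv.log_mem _
  add_mem := by
    rintro _ ⟨x, hx, rfl⟩ _ ⟨y, hy, rfl⟩
    refine ⟨_, ?_, hv.exponent_mul x y⟩
    have h1 := hle.mul _ _ y hx
    simp only [one_mul, zero_add] at h1
    exact hle.trans _ _ _ h1 hy
  total a ha := by
    obtain ⟨x, rfl⟩ := hv.exists_exponent_eq a ha
    refine (hle.total x (1, 0)).imp (fun h => ⟨x, h, rfl⟩) fun h => ?_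
    obtain ⟨z, hz, h'⟩ := (hv.le_iff_exists hle _ _).1 h
    exact ⟨z, hz, by rw [h', hv.exponent_one, zero_sub]⟩
  nonpos_mem γ hγ hγ0 := by
    obtain ⟨c, hc⟩ := hv.surj γ hγ
    refine ⟨(c, 0), hle.val_le _ _ ((hv.add_eq_iff _ _).2 ?_),
      Prod.ext (by rw [monomialExponent, hc, TropReal.log_tPow]) rfl⟩
    rwa [hc, hv.log_one, TropReal.log_tPow]

omit hle

/-- Order cones correspond to valuated monomial preorders. -/
noncomputable def preorderEquiv : OrderCone Γ M ≃ ValuatedMonomialPreorder M val :=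
  Equiv.ofBijective (fun Q => ⟨_, hv.isValuatedMonomialPreorder Q.2⟩)
    ⟨fun Q Q' h => Subtype.ext <| by
      have h1 : ∀ x : Kˣ × M, monomialExponent val x ∈ Q.1 ↔ monomialExponent val x ∈ Q'.1 :=
        fun x => by
          have := congrFun (congrFun (congrArg Subtype.val h) x) (1, 0)
          simp only [hv.exponent_one, sub_zero] at this
          exact iff_of_eq this
      ext a
      constructor
      · intro ha
        obtain ⟨x, rfl⟩ := hv.exists_exponent_eq a (Q.2.fst_mem a ha)
        exact (h1 x).1 ha
      · intro ha
        obtain ⟨x, rfl⟩ := hv.exists_exponent_eq a (Q'.2.fst_mem a ha)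
        exact (h1 x).2 ha,
    fun ⟨_, hle⟩ => ⟨⟨_, hv.isOrderCone hle⟩, Subtype.ext <| funext fun x => funext fun y =>
      propext (hv.le_iff_exists hle x y).symm⟩⟩

end IsValuationOnto

theorem leAt_single_iff {S : Subsemiring TropReal} (hS : IsSubsemifield S)
    {P : RingCon (AddMonoidAlgebra S M)} (s t : S) (hs : (s : TropReal) ≠ 0)
    (ht : (t : TropReal) ≠ 0) (u v : M) :
    P.leAt (AddMonoidAlgebra.single u s) (AddMonoidAlgebra.single v t) ↔
      ((TropReal.log s, u) : ℝ × M) - (TropReal.log t, v) ∈ termCone P := by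
  obtain ⟨s, hsS⟩ := s
  obtain ⟨t, htS⟩ := t
  obtain ⟨γ, rfl⟩ := MaxPlus.exists_eq_tPow hs
  obtain ⟨δ, rfl⟩ := MaxPlus.exists_eq_tPow ht
  exact leAt_term_iff hS (γ, u) (δ, v) hsS htS

/-- The coefficient map of a sub-semifield itself. -/
theorem isValuationOnto_subtype {S : Subsemiring TropReal} (hS : IsSubsemifield S) :
    IsValuationOnto (K := S) (valueSubgroup S hS) fun a => ((a : S) : TropReal) where
  map_mul _ _ := rfl
  exists_eq a := by
    have h : ((a : S) : TropReal) ≠ 0 := fun h => a.ne_zero (Subtype.ext h)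
    obtain ⟨γ, hγ⟩ := MaxPlus.exists_eq_tPow h
    refine ⟨γ, ?_, hγ⟩
    change MaxPlus.tPow γ ∈ S
    rw [← hγ]
    exact (a : S).2
  surj γ hγ := by
    have h1 : MaxPlus.tPow γ * MaxPlus.tPow (-γ) = (1 : TropReal) := by
      rw [← MaxPlus.tPow_add, add_neg_cancel, MaxPlus.tPow_zero]
    have h2 : (⟨MaxPlus.tPow γ, hγ⟩ : S) *
        ⟨MaxPlus.tPow (-γ), (valueSubgroup S hS).neg_mem hγ⟩ = 1 := Subtype.ext h1
    exact ⟨Units.mkOfMulEqOne _ _ h2, rfl⟩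

theorem isValuationOnto_addValuation {S : Subsemiring TropReal} (hS : IsSubsemifield S)
    {k : Type*} [Field k] (v : AddValuation k (WithTop (OrderDual ℝ)))
    (hv : ∀ a, Tropical.trop (v a) ∈ S) (hsurj : ∀ s ∈ S, ∃ a, Tropical.trop (v a) = s) :
    IsValuationOnto (K := k) (valueSubgroup S hS) fun a => Tropical.trop (v (a : k)) where
  map_mul a b := by
    rw [Units.val_mul, AddValuation.map_mul]
    rfl
  exists_eq a := by
    have h : Tropical.trop (v (a : k)) ≠ (0 : TropReal) := fun h =>
      a.ne_zero ((AddValuation.top_iff v).1 (Tropical.trop_injective h))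
    obtain ⟨γ, hγ⟩ := MaxPlus.exists_eq_tPow h
    refine ⟨γ, ?_, hγ⟩
    change MaxPlus.tPow γ ∈ S
    rw [← hγ]
    exact hv a
  surj γ hγ := by
    obtain ⟨a, ha⟩ := hsurj _ hγ
    have h : a ≠ 0 := by
      rintro rfl
      rw [AddValuation.map_zero] at ha
      exact MaxPlus.tPow_ne_zero γ ha.symm
    exact ⟨Units.mk0 a h, ha⟩

end Preorders

theorem theoremA {M : Type*} [AddCommGroup M] [Module.Free ℤ M] [Module.Finite ℤ M]
    (S : Subsemiring TropReal) (hS : IsSubsemifield S) :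
    -- Every flag is locally equivalent to a simplicial one, which has points `w_i ∈ C_i \ C_{i-1}`.
    (∀ C : ConeFlag M, ∃ C' : ConeFlag M,
      C'.IsSimplicial ∧ C.LocEquiv (valueGroup S) C' ∧ Nonempty C'.Selection) ∧
    -- Flags modulo local equivalence and prime congruences: `C` goes to `P_{C'}`.
    (∃ e : Quotient (ConeFlag.locSetoid (valueGroup S) M) ≃
        PrimeCongruence (AddMonoidAlgebra S M),
      ∀ C C' : ConeFlag M, C'.IsSimplicial → C.LocEquiv (valueGroup S) C' →
        ∀ w : C'.Selection, (e (Quotient.mk _ C)).1 = w.cong S) ∧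
    -- Prime congruences and prime filters: `P` goes to `F̃_P`.
    (∃ e : PrimeCongruence (AddMonoidAlgebra S M) ≃ FanPrimeFilter (valueGroup S) M,
      ∀ P, ((e P).1 : Set (FanSet (valueGroup S) M)) = filterOf P.1) ∧
    -- Prime congruences and valuated monomial preorders on the terms of `S[M]`:
    -- `P` goes to the restriction of `≤_P` to terms.
    (∃ e : PrimeCongruence (AddMonoidAlgebra S M) ≃
        ValuatedMonomialPreorder (K := S) M (fun a => ((a : S) : TropReal)),
      ∀ P (x y : Sˣ × M), (e P).1 x y ↔
        P.1.leAt (AddMonoidAlgebra.single x.2 (x.1 : S))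
          (AddMonoidAlgebra.single y.2 (y.1 : S))) ∧
    -- The same for the monomials of `k[M]`, for every field `k` with a valuation onto `S`.
    (∀ (k : Type*) [Field k] (v : AddValuation k (WithTop (OrderDual ℝ)))
      (hv : ∀ a, Tropical.trop (v a) ∈ S), (∀ s ∈ S, ∃ a, Tropical.trop (v a) = s) →
      ∃ e : PrimeCongruence (AddMonoidAlgebra S M) ≃
          ValuatedMonomialPreorder (K := k) M (fun a => Tropical.trop (v (a : k))),
        ∀ P (x y : kˣ × M), (e P).1 x y ↔
          P.1.leAt (AddMonoidAlgebra.single x.2 ⟨Tropical.trop (v (x.1 : k)), hv x.1⟩)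
            (AddMonoidAlgebra.single y.2 ⟨Tropical.trop (v (y.1 : k)), hv y.1⟩)) := by
  have hcong : ∀ {C : ConeFlag M} (w : C.Selection),
      termCone (w.cong S) = C.orderCone (valueGroup S) := fun {C} w => by
    rw [ConeFlag.Selection.cong, termCone_congOfPoints hS]
    exact (ConeFlag.orderCone_eq_lexCone (valueSubgroup S hS) w).symm
  refine ⟨ConeFlag.exists_isSimplicial_locEquiv (valueSubgroup S hS),
    ⟨(ConeFlag.quotientEquiv (valueSubgroup S hS) M).trans (primeEquiv M S hS).symm,
      fun C C' _ h w => ?_⟩,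
    ⟨(primeEquiv M S hS).trans (filterEquiv (valueSubgroup S hS) M), fun P => Set.ext fun U =>
      (P.2.mem_filterOf_iff hS U).symm⟩,
    ⟨(primeEquiv M S hS).trans (isValuationOnto_subtype hS).preorderEquiv, fun P x y => ?_⟩,
    fun k _ v hv hsurj => ⟨(primeEquiv M S hS).trans
      (isValuationOnto_addValuation hS v hv hsurj).preorderEquiv, fun P x y => ?_⟩⟩
  · set P := ((ConeFlag.quotientEquiv (valueSubgroup S hS) M).trans (primeEquiv M S hS).symm)
      (Quotient.mk _ C) with hP
    have hwprime : IsPrimeCongruence (w.cong S) := isPrimeCongruence_congOfPoints _ _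
    refine P.2.eq_of_termCone_eq hS hwprime ?_
    have h1 : primeEquiv M S hS P = ConeFlag.quotientEquiv (valueSubgroup S hS) M
        (Quotient.mk _ C) := Equiv.apply_symm_apply _ _
    have h2 : termCone P.1 = C.orderCone (valueGroup S) := congrArg Subtype.val h1
    rw [h2, hcong w]
    exact ConeFlag.locEquiv_iff_orderCone_eq.1 h
  · have hne : ∀ a : Sˣ, ((a : S) : TropReal) ≠ 0 := fun a h => a.ne_zero (Subtype.ext h)
    exact (leAt_single_iff hS _ _ (hne x.1) (hne y.1) x.2 y.2).symm
  · have hne : ∀ a : kˣ, Tropical.trop (v (a : k)) ≠ (0 : TropReal) := fun a h =>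
      a.ne_zero ((AddValuation.top_iff v).1 (Tropical.trop_injective h))
    exact (leAt_single_iff hS ⟨_, hv x.1⟩ ⟨_, hv y.1⟩ (hne x.1) (hne y.1) x.2 y.2).symm
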